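/- Let $d\ge 1$, $\mathbb R_+=(0,\infty)$, $\alpha\in(-1,\infty)^d$, $|\alpha|=\alpha_1+\dots+\alpha_d$ and $d\mu_\alpha(x)=\prod_{i=1}^d x_i^{2\alpha_i+1}\,dx$ on $\mathbb R_+^d$. With $L_n^a$ the Laguerre polynomial of degree $n$ and order $a>-1$, put, for $k\in\mathbb N^d$ and $x\in\mathbb R_+^d$, $$\ell_k^\alpha(x)=\prod_{i=1}^d \Big(\frac{2\,\Gamma(k_i+1)}{\Gamma(k_i+\alpha_i+1)}\Big)^{1/2}L_{k_i}^{\alpha_i}(x_i^2)\,e^{-x_i^2/2},\qquad \lambda_k=4|k|+2|\alpha|+2d .$$ Then $\{\ell_k^\alpha\}$ is an orthonormal basis of $L^2(\mathbb R_+^d,\mu_\alpha)$ and $\ell_k^\alpha$ is an eigenfunction, with eigenvalue $\lambda_k$, of the differential operator $-\Delta+\|x\|^2-\sum_{i}\frac{2\alpha_i+1}{x_i}\partial_{x_i}$; let $L$ be its self-adjoint extension whose spectral decomposition is given by the $\ell_k^\alpha$. Let $G_t(x,y)=\sum_{k\in\mathbb N^d} e^{-t\lambda_k}\ell_k^\alpha(x)\ell_k^\alpha(y)$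 for $t>0$, and let $T_0^{\alpha,\ell}=\mathrm{Id}$ and $$T_t^{\alpha,\ell}f(x)=\int_{\mathbb R_+^d}G_t(x,y)f(y)\,d\mu_\alpha(y),\qquad t>0,\ x\in\mathbb R_+^d,\ f\in L^1(\mu_\alpha)+L^\infty(\mu_\alpha).$$ The series and the integrals converge absolutely, and $T_t^{\alpha,\ell}f=e^{-tL}f=\sum_k e^{-t\lambda_k}\langle f,\ell_k^\alpha\rangle\,\ell_k^\alpha$ (in $L^2$) for all $f\in L^2(\mu_\alpha)$ and $t\ge 0$. A symmetric diffusion semigroup on a measure space $(X,\mu)$ is a family $\{T_t\}_{t\ge0}$ of linear operators, $T_0=\mathrm{Id}$, mapping $L^1+L^\infty$ into measurable functions, such that (i) for each $1\le p\le\infty$ every $T_t$ is a contraction on $L^p$ and $\{T_t\}$ is a semigroup there; (ii) each $T_t$ is self-adjoint on $L^2$; (iii) $T_tf\to f$ in $L^2$ as $t\to0^+$ for every $f\in L^2$. It is submarkovian if moreover $T_tf\ge0$ whenever $f\ge0$, and $T_t\mathbf 1\le\mathbf 1$, for all $t$; it is Markovian if moreover $T_tf\ge0$ whenever $f\ge0$,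 and $T_t\mathbf 1=\mathbf 1$, for all $t$. Theorem. For every $d\ge1$ and $\alpha\in(-1,\infty)^d$, $\{T_t^{\alpha,\ell}\}_{t\ge0}$ is a submarkovian, but not Markovian, symmetric diffusion semigroup on $(\mathbb R_+^d,\mu_\alpha)$, and for all $1\le p\le\infty$ and $t>0$, $$\|T_t^{\alpha,\ell}\|_{L^p(\mu_\alpha)\to L^p(\mu_\alpha)}\le(\cosh 2t)^{-(|\alpha|+d)} .$$ Moreover, in dimension $d=1$, for all $\alpha>-1$, $t>0$ and $x>0$, $$T_t^{\alpha,\ell}\mathbf 1(x)=(\cosh 2t)^{-\alpha-1}\exp\Big(-\tfrac12x^2\tanh 2t\Big).$$ -/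

import Mathlib

open MeasureTheory Filter Topology
open scoped ENNReal ComplexOrder

noncomputable section

/-! Symmetric diffusion semigroups on a measure space. Operators act on functions, and all
identities between functions are identities almost everywhere. -/

section Abstract

variable {X : Type*} [MeasurableSpace X] {𝕜 : Type*} [RCLike 𝕜]

/-- Membership in `L¹(μ) + L^∞(μ)`, the common domain of the operators. -/
def MemL1AddLinfty (f : X → 𝕜) (μ : Measure X) : Prop :=
  ∃ g h : X → 𝕜, MemLp g 1 μ ∧ MemLp h ∞ μ ∧ f = g + h

/-- The operator norm `‖S‖_{p → p}` of an operator `S` on `L^p(μ)`: the least constant `C` in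
`[0, ∞]` such that `‖S f‖_p ≤ C ‖f‖_p` for all `f` in `L^p(μ)`. -/
def lpOpNorm (S : (X → 𝕜) → X → 𝕜) (p : ℝ≥0∞) (μ : Measure X) : ℝ≥0∞ :=
  sInf {C : ℝ≥0∞ | ∀ f : X → 𝕜, MemLp f p μ → eLpNorm (S f) p μ ≤ C * eLpNorm f p μ}

/-- `{T t}_{t ≥ 0}` is a symmetric diffusion semigroup on `(X, μ)`, with common domain
`L¹(μ) + L^∞(μ)`. Only the values `T t` for `t ≥ 0` matter. -/
structure IsSymmetricDiffusionSemigroup (T : ℝ → (X → 𝕜) → X → 𝕜) (μ : Measure X) : Prop where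
  /-- `T t f` is measurable. -/
  aestronglyMeasurable : ∀ t, 0 ≤ t → ∀ f, MemL1AddLinfty f μ → AEStronglyMeasurable (T t f) μ
  /-- `T t` acts on classes of functions modulo equality almost everywhere. -/
  congr_ae : ∀ t, 0 ≤ t → ∀ f g, MemL1AddLinfty f μ → MemL1AddLinfty g μ →
    f =ᵐ[μ] g → T t f =ᵐ[μ] T t g
  /-- `T t` is additive. -/
  map_add : ∀ t, 0 ≤ t → ∀ f g, MemL1AddLinfty f μ → MemL1AddLinfty g μ →
    T t (f + g) =ᵐ[μ] T t f + T t g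
  /-- `T t` is homogeneous. -/
  map_smul : ∀ t, 0 ≤ t → ∀ (c : 𝕜) (f), MemL1AddLinfty f μ → T t (c • f) =ᵐ[μ] c • T t f
  /-- `T 0` is the identity. -/
  zero : ∀ f, MemL1AddLinfty f μ → T 0 f =ᵐ[μ] f
  /-- `T t` maps `L^p` into itself, for `1 ≤ p ≤ ∞`. -/
  memLp : ∀ p : ℝ≥0∞, 1 ≤ p → ∀ t, 0 ≤ t → ∀ f, MemLp f p μ → MemLp (T t f) p μ
  /-- `T t` is a contraction on `L^p`, for `1 ≤ p ≤ ∞`. -/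
  contraction : ∀ p : ℝ≥0∞, 1 ≤ p → ∀ t, 0 ≤ t → lpOpNorm (T t) p μ ≤ 1
  /-- The semigroup property on `L^p`, for `1 ≤ p ≤ ∞`. -/
  semigroup : ∀ p : ℝ≥0∞, 1 ≤ p → ∀ s t, 0 ≤ s → 0 ≤ t → ∀ f, MemLp f p μ →
    T (s + t) f =ᵐ[μ] T s (T t f)
  /-- `T t` is self-adjoint on `L²`. -/
  selfAdjoint : ∀ t, 0 ≤ t → ∀ f g, MemLp f 2 μ → MemLp g 2 μ →
    ∫ x, T t f x * star (g x) ∂μ = ∫ x, f x * star (T t g x) ∂μ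
  /-- `T t f → f` in `L²` as `t → 0⁺`, for every `f` in `L²`. -/
  continuous_zero : ∀ f, MemLp f 2 μ →
    Tendsto (fun t => eLpNorm (T t f - f) 2 μ) (𝓝[>] 0) (𝓝 0)

/-- Each `T t` preserves nonnegative functions. -/
def IsPositiveFamily (T : ℝ → (X → 𝕜) → X → 𝕜) (μ : Measure X) : Prop :=
  ∀ t, 0 ≤ t → ∀ f, MemL1AddLinfty f μ → (∀ᵐ x ∂μ, 0 ≤ f x) → ∀ᵐ x ∂μ, 0 ≤ T t f x

/-- A Markovian symmetric diffusion semigroup: positive, and `T t 1 = 1` for all `t`. -/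
structure IsMarkovianSemigroup (T : ℝ → (X → 𝕜) → X → 𝕜) (μ : Measure X) : Prop where
  isSymmetricDiffusionSemigroup : IsSymmetricDiffusionSemigroup T μ
  positive : IsPositiveFamily T μ
  conservative : ∀ t, 0 ≤ t → ∀ᵐ x ∂μ, T t (fun _ => 1) x = 1

/-- A submarkovian symmetric diffusion semigroup: positive, and `T t 1 ≤ 1` for all `t`. -/
structure IsSubmarkovianSemigroup (T : ℝ → (X → 𝕜) → X → 𝕜) (μ : Measure X) : Prop where
  isSymmetricDiffusionSemigroup : IsSymmetricDiffusionSemigroup T μ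
  positive : IsPositiveFamily T μ
  subconservative : ∀ t, 0 ≤ t → ∀ᵐ x ∂μ, T t (fun _ => 1) x ≤ 1

end Abstract

namespace LaguerreConv

/-- The open orthant `ℝ₊^d = (0, ∞)^d`. -/
def orthant (d : ℕ) : Set (Fin d → ℝ) := {x | ∀ i, 0 < x i}

/-- The measure `dμ_α(x) = (∏ i, x_i ^ (2 α_i + 1)) dx` on `ℝ₊^d`, as a measure on `ℝ^d`
concentrated on the orthant. -/
def measure {d : ℕ} (α : Fin d → ℝ) : Measure (Fin d → ℝ) :=
  (volume.restrict (orthant d)).withDensity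
    (fun x => ENNReal.ofReal (∏ i, x i ^ (2 * α i + 1)))

/-- The Laguerre polynomial `L_n^a` of degree `n` and order `a > -1`:
`L_n^a(x) = ∑_{j ≤ n} Γ(n + a + 1) / (Γ(j + a + 1) (n - j)! j!) (-x)^j`. -/
def laguerre (n : ℕ) (a x : ℝ) : ℝ :=
  ∑ j ∈ Finset.range (n + 1),
    Real.Gamma (n + a + 1) / (Real.Gamma (j + a + 1) * (n - j).factorial * j.factorial) * (-x) ^ j

/-- The one-dimensional Laguerre functions of convolution type,
`ℓ_n^a(x) = (2 Γ(n + 1) / Γ(n + a + 1))^{1/2} L_n^a(x²) e^{-x²/2}`. -/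
def ell1 (n : ℕ) (a x : ℝ) : ℝ :=
  √2 * √(Real.Gamma (n + 1) / Real.Gamma (n + a + 1)) * laguerre n a (x ^ 2) *
    Real.exp (-x ^ 2 / 2)

variable {d : ℕ}

/-- The multi-dimensional Laguerre functions of convolution type (tensor products). -/
def ell (α : Fin d → ℝ) (k : Fin d → ℕ) (x : Fin d → ℝ) : ℝ :=
  ∏ i, ell1 (k i) (α i) (x i)

/-- The eigenvalues `4|k| + 2|α| + 2d`. -/
def eigenvalue (α : Fin d → ℝ) (k : Fin d → ℕ) : ℝ :=
  4 * ∑ i, (k i : ℝ) + 2 * ∑ i, α i + 2 * d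

/-- The differential operator
`-Δ + ‖x‖² - ∑ i, ((2 α_i + 1) / x_i) ∂/∂x_i` (with the Euclidean norm). -/
def diffOp (α : Fin d → ℝ) (f : (Fin d → ℝ) → ℝ) (x : Fin d → ℝ) : ℝ :=
  -(∑ i, iteratedDeriv 2 (fun s => f (Function.update x i s)) (x i)) + (∑ i, x i ^ 2) * f x -
    ∑ i, (2 * α i + 1) / x i * deriv (fun s => f (Function.update x i s)) (x i)

/-- The heat kernel `G_t(x, y) = ∑_k e^{-t (4|k| + 2|α| + 2d)} ℓ_k(x) ℓ_k(y)`. -/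
def kernel (α : Fin d → ℝ) (t : ℝ) (x y : Fin d → ℝ) : ℝ :=
  ∑' k : Fin d → ℕ, Real.exp (-t * eigenvalue α k) * (ell α k x * ell α k y)

/-- The Laguerre semigroup of convolution type: `T_0 f = f` and
`T_t f(x) = ∫ G_t(x, y) f(y) dμ_α(y)` for `t > 0`. -/
def semigroup (𝕜 : Type*) [RCLike 𝕜] (α : Fin d → ℝ) (t : ℝ) (f : (Fin d → ℝ) → 𝕜)
    (x : Fin d → ℝ) : 𝕜 :=
  if t = 0 then f x else ∫ y, kernel α t x y • f y ∂(measure α)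

/-- The partial sum, over a finite set `s` of multi-indices, of the spectral series
`∑_k e^{-t (4|k| + 2|α| + 2d)} ⟨f, ℓ_k⟩ ℓ_k` which defines `exp(-tL) f` for `f` in `L²(μ_α)`. -/
def spectralPartialSum {𝕜 : Type*} [RCLike 𝕜] (α : Fin d → ℝ) (t : ℝ) (f : (Fin d → ℝ) → 𝕜)
    (s : Finset (Fin d → ℕ)) (x : Fin d → ℝ) : 𝕜 :=
  ∑ k ∈ s, (Real.exp (-t * eigenvalue α k) * ell α k x) • ∫ y, ell α k y • f y ∂(measure α)

/-- On `L²(μ_α)` the operators `T t`, `t ≥ 0`, are `exp(-tL)`, where `L` is the self-adjoint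
extension of the differential operator `diffOp α` whose spectral decomposition is given by the
`ℓ_k`: these are eigenfunctions of `diffOp α`, they are orthonormal, and the spectral series of
`exp(-tL) f` converges to `T t f` in `L²(μ_α)` for every `f` in `L²(μ_α)` (for `t = 0` and
`T 0 = Id` this is completeness of the system). -/
structure IsHeatSemigroup {𝕜 : Type*} [RCLike 𝕜] (α : Fin d → ℝ)
    (T : ℝ → ((Fin d → ℝ) → 𝕜) → (Fin d → ℝ) → 𝕜) : Prop where
  eigen : ∀ k, ∀ x ∈ orthant d, diffOp α (ell α k) x = eigenvalue α k * ell α k x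
  memLp : ∀ k, MemLp (ell α k) 2 (measure α)
  orthonormal : ∀ j k, ∫ x, ell α j x * ell α k x ∂(measure α) = if j = k then 1 else 0
  zero : ∀ f, MemLp f 2 (measure α) → T 0 f =ᵐ[measure α] f
  hasSum : ∀ t, 0 ≤ t → ∀ f, MemLp f 2 (measure α) →
    Tendsto (fun s => eLpNorm (T t f - spectralPartialSum α t f s) 2 (measure α)) atTop (𝓝 0)

end LaguerreConv

end

noncomputable section

namespace LaguerreConv

/-! Everything rests on a closed form of the heat kernel. In one dimension the Hille-Hardy formula
(`hasSum_hille_hardy`) at `w = e^{-4t}` sums the spectral series to a Gaussian times a Bessel series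
in a square with positive coefficients (`hasSum_heatKernel1`). Hence the kernel is nonnegative, and
integrating its series term by term gives `T_t 1` explicitly (`integral_heatKernel1`). In dimension
`d` the kernel is a product of one-dimensional ones, so its mass in either variable is at most
`(cosh 2t)^{-(|α|+d)}` (`integral_kernel_le`). Schur's test turns this into the bound on every
`L^p`. The bound is strictly below one for `t > 0`, so the semigroup is submarkovian and cannot be
Markovian.

The semigroup law is Fubini combined with Chapman-Kolmogorov (`integral_kernel_mul_kernel`), which
follows from orthonormality of the `ℓ_k`. Strong continuity and the identification with `exp(-tL)`
need completeness. A function orthogonal to all `ℓ_k` has, after multiplication by a Gaussian,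
vanishing moments against all products of `exp(-m_i x_i²)`; an algebra of bounded functions
separating points determines finite measures, so the function vanishes
(`ae_eq_zero_of_integral_ell_eq_zero`). Contractivity carries the convergence of the expansion from
`t = 0` to every `t`. -/

/-! ### Generating function of the Laguerre polynomials. -/

theorem hasSum_of_eq {ι : Type*} {E : Type*} [AddCommMonoid E] [TopologicalSpace E]
    {f g : ι → E} {s t : E} (h : HasSum f s) (hfg : ∀ i, g i = f i) (hst : t = s) :
    HasSum g t := by
  rw [hst, funext hfg]; exact h

/-- These are the coefficients of the binomial series of `(1 - w) ^ (-b)`; in Gamma form they cancel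
against the Gamma factors of the Laguerre coefficients. -/
theorem choose_add_sub_one_eq_gamma {b : ℝ} (hb : 0 < b) (n : ℕ) :
    Ring.choose (b + n - 1) n = Real.Gamma (n + b) / (Real.Gamma b * n.factorial) := by
  have h1 : Ring.choose (b + n - 1) n = Ring.multichoose b n := by
    rw [Ring.choose]; congr 1; ring
  have h2 : ∀ n : ℕ, (ascPochhammer ℕ n).smeval b = Real.Gamma (n + b) / Real.Gamma b := by
    intro n
    induction n with
    | zero => simp [ascPochhammer_zero, (Real.Gamma_pos_of_pos hb).ne']
    | succ n ih =>
      rw [ascPochhammer_succ_right, Polynomial.smeval_mul, ih]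
      have : ((n + 1 : ℕ) : ℝ) + b = (n + b) + 1 := by push_cast; ring
      rw [this, Real.Gamma_add_one (by positivity)]
      simp only [Polynomial.smeval_add, Polynomial.smeval_X, Polynomial.smeval_natCast,
        pow_one, pow_zero, nsmul_eq_mul, mul_one]
      ring
  have h3 := Ring.factorial_nsmul_multichoose_eq_ascPochhammer b n
  rw [h2, nsmul_eq_mul] at h3
  have h4 : (n.factorial : ℝ) ≠ 0 := by positivity
  have h5 := (Real.Gamma_pos_of_pos hb).ne'
  rw [h1]
  field_simp
  field_simp at h3
  linarith

theorem hasSum_gamma_mul_pow {b w : ℝ} (hb : 0 < b) (hw : |w| < 1) :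
    HasSum (fun m : ℕ => Real.Gamma (m + b) / m.factorial * w ^ m)
      (Real.Gamma b * (1 - w) ^ (-b)) := by
  have h := (Real.one_div_one_sub_rpow_hasFPowerSeriesOnBall_zero b).hasSum
    (y := w) (by simpa [enorm_eq_nnnorm, ← NNReal.coe_lt_coe] using hw)
  have h1 : 0 < 1 - w := by have := (abs_lt.1 hw).2; linarith
  have h5 := (Real.Gamma_pos_of_pos hb).ne'
  refine hasSum_of_eq (h.mul_left (Real.Gamma b)) (fun m => ?_) ?_
  · rw [FormalMultilinearSeries.ofScalars_apply_eq, choose_add_sub_one_eq_gamma hb, smul_eq_mul]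
    field_simp
  · rw [zero_add, Real.rpow_neg h1.le, one_div]

/-- The coefficient of `(-x)^j` in `L_n^a(x)`. -/
def laguerreCoeff (n : ℕ) (a : ℝ) (j : ℕ) : ℝ :=
  Real.Gamma (n + a + 1) / (Real.Gamma (j + a + 1) * (n - j).factorial * j.factorial)

theorem laguerre_eq_sum (n : ℕ) (a x : ℝ) :
    laguerre n a x = ∑ j ∈ Finset.range (n + 1), laguerreCoeff n a j * (-x) ^ j := rfl

theorem gamma_pos {a : ℝ} (ha : -1 < a) (n : ℕ) : 0 < Real.Gamma (n + a + 1) :=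
  Real.Gamma_pos_of_pos (by have : (0 : ℝ) ≤ n := n.cast_nonneg; linarith)

theorem laguerreCoeff_pos {a : ℝ} (ha : -1 < a) (n j : ℕ) : 0 < laguerreCoeff n a j := by
  have := gamma_pos ha n
  have := gamma_pos ha j
  unfold laguerreCoeff
  positivity

/-- The coefficients of `(-x)^j` are positive, so `-|x|` makes every term nonnegative. This majorant
supplies the absolute convergence in the generating-function arguments. -/
theorem abs_laguerre_le {a : ℝ} (ha : -1 < a) (n : ℕ) (x : ℝ) :
    |laguerre n a x| ≤ laguerre n a (-|x|) := by
  simp only [laguerre_eq_sum]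
  refine (Finset.abs_sum_le_sum_abs _ _).trans (Finset.sum_le_sum fun j _ => ?_)
  rw [abs_mul, abs_of_pos (laguerreCoeff_pos ha n j), abs_pow, abs_neg, neg_neg]

theorem laguerre_neg_abs_nonneg {a : ℝ} (ha : -1 < a) (n : ℕ) (x : ℝ) :
    0 ≤ laguerre n a (-|x|) := (abs_nonneg _).trans (abs_laguerre_le ha n x)

/-- The double series behind the generating function of the Laguerre polynomials. -/
theorem hasSum_generating_double {a w : ℝ} (ha : -1 < a) (hw : |w| < 1) (x : ℝ) :
    HasSum (fun p : ℕ × ℕ => laguerreCoeff (p.1 + p.2) a p.1 * (-x) ^ p.1 * w ^ (p.1 + p.2))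
      ((1 - w) ^ (-a - 1) * Real.exp (-x * w / (1 - w))) := by
  -- With `n = j + m`, the sum over `m` is a binomial series; what remains in `j` is an exponential
  -- series.
  have inner : ∀ (x w : ℝ), |w| < 1 → ∀ j : ℕ,
      HasSum (fun m : ℕ => laguerreCoeff (j + m) a j * (-x) ^ j * w ^ (j + m))
        ((1 - w) ^ (-a - 1) * ((-x * w / (1 - w)) ^ j / j.factorial)) := by
    intro x w hw j
    have h1 : 0 < 1 - w := by have := (abs_lt.1 hw).2; linarith
    have hj : 0 < (j : ℝ) + a + 1 := by have : (0 : ℝ) ≤ j := j.cast_nonneg; linarith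
    have hG := (gamma_pos ha j).ne'
    refine hasSum_of_eq ((hasSum_gamma_mul_pow hj hw).mul_left
      ((-x) ^ j * w ^ j / (Real.Gamma (j + a + 1) * j.factorial))) (fun m => ?_) ?_
    · have : ((j + m : ℕ) : ℝ) + a + 1 = m + (j + a + 1) := by push_cast; ring
      rw [laguerreCoeff, this, Nat.add_sub_cancel_left, pow_add]
      field_simp
    · have : -((j : ℝ) + a + 1) = (-a - 1) - j := by ring
      rw [this, Real.rpow_sub h1 (-a - 1), Real.rpow_natCast, div_pow, mul_pow]
      field_simp
  have outer : ∀ (x w : ℝ), HasSum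
      (fun j : ℕ => (1 - w) ^ (-a - 1) * ((-x * w / (1 - w)) ^ j / j.factorial))
        ((1 - w) ^ (-a - 1) * Real.exp (-x * w / (1 - w))) := fun x w => by
    have h := NormedSpace.expSeries_div_hasSum_exp (-x * w / (1 - w))
    rw [← Real.exp_eq_exp_ℝ] at h
    exact h.mul_left _
  have hs : Summable
      (fun p : ℕ × ℕ => laguerreCoeff (p.1 + p.2) a p.1 * (-x) ^ p.1 * w ^ (p.1 + p.2)) := by
    have hw' : |(|w|)| < 1 := by rwa [abs_abs]
    refine Summable.of_norm ?_
    have e : ∀ p : ℕ × ℕ,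
        ‖laguerreCoeff (p.1 + p.2) a p.1 * (-x) ^ p.1 * w ^ (p.1 + p.2)‖ =
          laguerreCoeff (p.1 + p.2) a p.1 * (-(-|x|)) ^ p.1 * |w| ^ (p.1 + p.2) := fun p => by
      rw [norm_mul, norm_mul, norm_pow, norm_pow, norm_neg, neg_neg, Real.norm_eq_abs,
        abs_of_pos (laguerreCoeff_pos ha _ _), Real.norm_eq_abs, Real.norm_eq_abs]
    simp only [e]
    -- The absolute values form the same double series at `-|x|`, `|w|`, whose iterated sums have
    -- just been computed.
    refine (summable_prod_of_nonneg fun p => ?_).2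
      ⟨fun j => (inner (-|x|) |w| hw' j).summable, ?_⟩
    · have := laguerreCoeff_pos ha (p.1 + p.2) p.1
      simp only [neg_neg, Pi.zero_apply]
      positivity
    · simp only [(inner (-|x|) |w| hw' _).tsum_eq]
      exact (outer _ _).summable
  refine hasSum_of_eq hs.hasSum (fun _ => rfl) ?_
  rw [hs.tsum_prod' fun j => (inner x w hw j).summable]
  simp only [(inner x w hw _).tsum_eq, (outer x w).tsum_eq]

/-- The generating function of the Laguerre polynomials. -/
theorem hasSum_laguerre_mul_pow {a w : ℝ} (ha : -1 < a) (hw : |w| < 1) (x : ℝ) :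
    HasSum (fun n : ℕ => laguerre n a x * w ^ n)
      ((1 - w) ^ (-a - 1) * Real.exp (-x * w / (1 - w))) := by
  have h := hasSum_generating_double ha hw x
  have h2 := (Finset.HasAntidiagonal.sigmaAntidiagonalEquivProd.hasSum_iff.2 h).sigma
    fun n => hasSum_fintype _
  refine hasSum_of_eq h2 (fun n => ?_) rfl
  rw [laguerre_eq_sum, Finset.sum_mul, ← Finset.Nat.sum_antidiagonal_eq_sum_range_succ
    (fun i j => laguerreCoeff n a i * (-x) ^ i * w ^ n), ← Finset.sum_coe_sort]
  refine Finset.sum_congr rfl fun p _ => ?_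
  have := Finset.HasAntidiagonal.mem_antidiagonal.1 p.2
  simp [Finset.HasAntidiagonal.sigmaAntidiagonalEquivProd, this]

/-! ### Taylor expansion of the generating function at a point of `[0, 1)`. -/

theorem hasFPowerSeriesOnBall_of_hasSum {f : ℝ → ℝ} {c : ℕ → ℝ} {r : NNReal} (hr : 0 < r)
    (h : ∀ y : ℝ, |y| < r → HasSum (fun n => c n * y ^ n) (f y)) :
    HasFPowerSeriesOnBall f (FormalMultilinearSeries.ofScalars ℝ c) 0 r where
  r_le := by
    refine le_of_forall_lt_imp_le_of_dense fun s hs => ?_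
    lift s to NNReal using (hs.trans ENNReal.coe_lt_top).ne
    have hs' : (s : ℝ) < r := by exact_mod_cast hs
    refine FormalMultilinearSeries.le_radius_of_summable_norm _ ?_
    have := (h s (by simpa using hs')).summable.norm
    refine this.congr fun n => ?_
    simp
  r_pos := by exact_mod_cast hr
  hasSum := fun {y} hy => by
    have hy' : |y| < r := by
      simpa [enorm_eq_nnnorm, ← NNReal.coe_lt_coe] using hy
    simpa [FormalMultilinearSeries.ofScalars_apply_eq, mul_comm] using h y hy'

theorem coeff_eq_of_hasSum {f : ℝ → ℝ} {c c' : ℕ → ℝ} {r : ℝ} (hr : 0 < r)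
    (h : ∀ y : ℝ, |y| < r → HasSum (fun n => c n * y ^ n) (f y))
    (h' : ∀ y : ℝ, |y| < r → HasSum (fun n => c' n * y ^ n) (f y)) : c = c' := by
  lift r to NNReal using hr.le
  have hr' : 0 < r := by exact_mod_cast hr
  have := ((hasFPowerSeriesOnBall_of_hasSum hr' h).hasFPowerSeriesAt).eq_formalMultilinearSeries
    (hasFPowerSeriesOnBall_of_hasSum hr' h').hasFPowerSeriesAt
  ext n
  simpa using congrArg (fun p => FormalMultilinearSeries.coeff p n) this

theorem hasSum_swap {f : ℕ → ℕ → ℝ} (hs : Summable (fun p : ℕ × ℕ => f p.1 p.2)) {g h : ℕ → ℝ}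
    {S : ℝ} (h1 : ∀ i, HasSum (fun j => f i j) (g i)) (h2 : HasSum g S)
    (h3 : ∀ j, HasSum (fun i => f i j) (h j)) : HasSum h S := by
  have h4 := hs.hasSum.prod_fiberwise h1
  rw [h2.unique h4]
  exact ((Equiv.prodComm ℕ ℕ).hasSum_iff.2 hs.hasSum).prod_fiberwise h3

theorem summable_prod_of_hasSum {f : ℕ → ℕ → ℝ} (h0 : ∀ i j, 0 ≤ f i j) {g : ℕ → ℝ}
    (h1 : ∀ i, HasSum (fun j => f i j) (g i)) (h2 : Summable g) :
    Summable (fun p : ℕ × ℕ => f p.1 p.2) := by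
  refine (summable_prod_of_nonneg fun p => h0 p.1 p.2).2 ⟨fun i => (h1 i).summable, ?_⟩
  exact h2.congr fun i => (h1 i).tsum_eq.symm

theorem summable_abs_laguerre_mul_pow {a s : ℝ} (ha : -1 < a) (hs : 0 ≤ s) (hs1 : s < 1) (x : ℝ) :
    Summable (fun n : ℕ => |laguerre n a x| * s ^ n) :=
  Summable.of_nonneg_of_le (fun n => by positivity)
    (fun n => mul_le_mul_of_nonneg_right (abs_laguerre_le ha n x) (by positivity))
    (hasSum_laguerre_mul_pow ha (by rwa [abs_of_nonneg hs]) (-|x|)).summable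

/-- The binomial theorem as a series over all `j`: for `j > n` the binomial coefficient vanishes, so
the truncated `n - j` is harmless. -/
theorem hasSum_choose_mul_pow (w h : ℝ) (n : ℕ) :
    HasSum (fun j : ℕ => (n.choose j : ℝ) * w ^ (n - j) * h ^ j) ((w + h) ^ n) := by
  rw [add_comm, add_pow]
  refine hasSum_of_eq (hasSum_sum_of_ne_finset_zero
    (f := fun j : ℕ => (n.choose j : ℝ) * w ^ (n - j) * h ^ j) (s := Finset.range (n + 1))
    fun j hj => ?_) (fun _ => rfl) (Finset.sum_congr rfl fun j _ => by ring)
  rw [Nat.choose_eq_zero_of_lt (by simpa using hj)]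
  simp

/-- Summing absolute values over `j` gives `|L_n(x)| (w + |h|)^n`, and `w + |h| < 1`. -/
theorem summable_taylor_double {a w h : ℝ} (ha : -1 < a) (hw : 0 ≤ w) (hh : |h| < 1 - w) (x : ℝ) :
    Summable (fun p : ℕ × ℕ =>
      laguerre p.1 a x * ((p.1.choose p.2 : ℝ) * w ^ (p.1 - p.2) * h ^ p.2)) := by
  have key := summable_prod_of_hasSum
    (f := fun n j => |laguerre n a x| * ((n.choose j : ℝ) * w ^ (n - j) * |h| ^ j))
    (fun n j => by positivity) (fun n => (hasSum_choose_mul_pow w |h| n).mul_left _)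
    (summable_abs_laguerre_mul_pow ha (by positivity) (by linarith) x)
  refine Summable.of_norm (key.congr fun p => ?_)
  simp only [norm_mul, norm_pow, Real.norm_eq_abs, abs_of_nonneg hw, Nat.abs_cast]

/-- The Taylor coefficients of the generating function at a point `w`. -/
theorem hasSum_choose_mul_laguerre {a w : ℝ} (ha : -1 < a) (hw : 0 ≤ w) (hw1 : w < 1) (x : ℝ)
    (j : ℕ) :
    HasSum (fun n : ℕ => laguerre n a x * ((n.choose j : ℝ) * w ^ (n - j)))
      ((1 - w) ^ (-a - 1) * Real.exp (-x * w / (1 - w)) *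
        (laguerre j a (x / (1 - w)) / (1 - w) ^ j)) := by
  have h1 : 0 < 1 - w := by linarith
  have hsum : ∀ j : ℕ, Summable
      (fun n : ℕ => laguerre n a x * ((n.choose j : ℝ) * w ^ (n - j))) := fun j => by
    -- Any nonzero `h` with `|h| < 1 - w` would do; its power is divided out afterwards.
    have h := (summable_taylor_double (h := (1 - w) / 2) ha hw
      (by rw [abs_of_pos (by linarith)]; linarith) x).prod_symm.prod_factor j
    have h2 := h.mul_right (((1 - w) / 2) ^ j)⁻¹
    refine h2.congr fun n => ?_
    have : ((1 - w) / 2) ^ j ≠ 0 := by positivity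
    simp only [Prod.swap]
    field_simp
  -- The generating function at `w + h` is expanded in `h` twice: by the binomial theorem in each
  -- `(w + h)^n`, and as the generating function at `x / (1 - w)` in the variable `h / (1 - w)`.
  -- Uniqueness of coefficients gives the claim.
  have key := coeff_eq_of_hasSum (r := 1 - w) h1
    (f := fun h => (1 - (w + h)) ^ (-a - 1) * Real.exp (-x * (w + h) / (1 - (w + h))))
    (c := fun j => ∑' n : ℕ, laguerre n a x * ((n.choose j : ℝ) * w ^ (n - j)))
    (c' := fun j => (1 - w) ^ (-a - 1) * Real.exp (-x * w / (1 - w)) *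
        (laguerre j a (x / (1 - w)) / (1 - w) ^ j)) ?_ ?_
  · exact hasSum_of_eq (hsum j).hasSum (fun _ => rfl) (congrFun key j).symm
  · intro h hh
    have hwh : |w + h| < 1 := (abs_add_le _ _).trans_lt (by rw [abs_of_nonneg hw]; linarith)
    refine hasSum_swap
      (f := fun n j => laguerre n a x * ((n.choose j : ℝ) * w ^ (n - j) * h ^ j))
      (summable_taylor_double ha hw hh x) (fun n => (hasSum_choose_mul_pow w h n).mul_left _)
      (hasSum_laguerre_mul_pow ha hwh x) fun j => ?_
    exact hasSum_of_eq ((hsum j).hasSum.mul_right (h ^ j)) (fun n => by ring) rfl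
  · intro h hh
    have hu : |h / (1 - w)| < 1 := by
      rw [abs_div, abs_of_pos h1, div_lt_one h1]; exact hh
    have h2 : 0 < 1 - (w + h) := by have := (abs_lt.1 hh).2; linarith
    have e1 : 1 - (w + h) = (1 - w) * (1 - h / (1 - w)) := by field_simp; ring
    have h3 : 0 < 1 - h / (1 - w) := by
      have := (abs_lt.1 hu).2; linarith
    refine hasSum_of_eq ((hasSum_laguerre_mul_pow ha hu (x / (1 - w))).mul_left
      ((1 - w) ^ (-a - 1) * Real.exp (-x * w / (1 - w)))) (fun j => ?_) ?_
    · rw [div_pow]; field_simp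
    · have e2 : -x * (w + h) / (1 - (w + h)) = -x * w / (1 - w) +
          -(x / (1 - w)) * (h / (1 - w)) / (1 - h / (1 - w)) := by
        have e3 : 1 - h / (1 - w) = (1 - (w + h)) / (1 - w) := by field_simp; ring
        rw [e3]
        field_simp
        ring
      rw [e2, Real.exp_add, e1, Real.mul_rpow h1.le h3.le]
      ring

/-! ### The Bessel series and the Hille-Hardy formula. -/

theorem summable_pow_div_gamma {a : ℝ} (ha : -1 < a) (z : ℝ) :
    Summable (fun m : ℕ => z ^ m / Real.Gamma (m + a + 1)) := by
  rcases eq_or_ne z 0 with rfl | hz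
  · refine summable_of_ne_finset_zero (s := {0}) fun m hm => ?_
    rw [zero_pow (by simpa using hm), zero_div]
  refine summable_of_ratio_test_tendsto_lt_one zero_lt_one
    (Eventually.of_forall fun m => div_ne_zero (pow_ne_zero _ hz) (gamma_pos ha m).ne') ?_
  have h : Tendsto (fun m : ℕ => |z| / ((m : ℝ) + (a + 1))) atTop (𝓝 0) :=
    Tendsto.div_atTop tendsto_const_nhds
      (tendsto_atTop_add_const_right _ _ tendsto_natCast_atTop_atTop)
  refine h.congr fun m => ?_
  have hm : 0 < (m : ℝ) + (a + 1) := by have : (0 : ℝ) ≤ m := m.cast_nonneg; linarith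
  have e : ((m + 1 : ℕ) : ℝ) + a + 1 = (m + a + 1) + 1 := by push_cast; ring
  have hG := gamma_pos ha m
  rw [e, Real.Gamma_add_one (by linarith), norm_div, norm_div, norm_mul, norm_pow, norm_pow,
    Real.norm_of_nonneg hG.le, Real.norm_of_nonneg (by linarith : 0 ≤ (m : ℝ) + a + 1),
    Real.norm_eq_abs]
  have : |z| ≠ 0 := abs_ne_zero.2 hz
  have hm' : 0 < (m : ℝ) + a + 1 := by linarith
  rw [pow_succ, ← add_assoc]
  field_simp

/-- The entire function `∑_m z^m / (m! Γ(m + a + 1))`, a normalisation of the modified Bessel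
function of order `a`. -/
def besselSeries (a z : ℝ) : ℝ := ∑' m : ℕ, z ^ m / (m.factorial * Real.Gamma (m + a + 1))

theorem summable_abs_besselSeries {a : ℝ} (ha : -1 < a) (z : ℝ) :
    Summable (fun m : ℕ => |z| ^ m / (m.factorial * Real.Gamma (m + a + 1))) := by
  refine Summable.of_nonneg_of_le (fun m => ?_) (fun m => ?_) (summable_pow_div_gamma ha |z|)
  · have := gamma_pos ha m
    positivity
  · have := gamma_pos ha m
    refine div_le_div_of_nonneg_left (by positivity) this ?_
    exact le_mul_of_one_le_left this.le (by exact_mod_cast m.factorial_pos)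

theorem hasSum_besselSeries {a : ℝ} (ha : -1 < a) (z : ℝ) :
    HasSum (fun m : ℕ => z ^ m / (m.factorial * Real.Gamma (m + a + 1))) (besselSeries a z) := by
  refine Summable.hasSum (Summable.of_norm ((summable_abs_besselSeries ha z).congr fun m => ?_))
  have := gamma_pos ha m
  rw [norm_div, norm_pow, Real.norm_eq_abs, Real.norm_of_nonneg (by positivity)]

/-- Cauchy product of the exponential series with the Bessel series. -/
theorem hasSum_laguerre_div_gamma {a : ℝ} (ha : -1 < a) (x s : ℝ) :
    HasSum (fun j : ℕ => laguerre j a x * s ^ j / Real.Gamma (j + a + 1))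
      (Real.exp s * besselSeries a (-x * s)) := by
  have hE := NormedSpace.expSeries_div_hasSum_exp s
  rw [← Real.exp_eq_exp_ℝ] at hE
  have hB := hasSum_besselSeries ha (-x * s)
  have hE' := (NormedSpace.expSeries_div_hasSum_exp |s|).summable
  have hEn : Summable (fun n : ℕ => ‖s ^ n / (n.factorial : ℝ)‖) := by
    refine hE'.congr fun n => ?_
    rw [norm_div, norm_pow, Real.norm_eq_abs, Real.norm_of_nonneg (by positivity)]
  have hBn := hB.summable.norm
  have h1 := (summable_norm_sum_mul_range_of_summable_norm hBn hEn).of_norm.hasSum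
  rw [← tsum_mul_tsum_eq_tsum_sum_range_of_summable_norm hBn hEn, hE.tsum_eq, hB.tsum_eq] at h1
  refine hasSum_of_eq h1 (fun j => ?_) (mul_comm _ _)
  rw [laguerre_eq_sum, Finset.sum_mul, Finset.sum_div]
  refine Finset.sum_congr rfl fun i hi => ?_
  have hi' : i ≤ j := Nat.lt_succ_iff.1 (Finset.mem_range.1 hi)
  have h2 := gamma_pos ha i
  have h3 := gamma_pos ha j
  rw [laguerreCoeff, mul_pow, ← Nat.add_sub_cancel' hi', pow_add]
  simp only [Nat.add_sub_cancel_left]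
  rw [Nat.add_sub_cancel' hi']
  field_simp

/-- This converts the binomials from the Taylor coefficients into the coefficients of the second
Laguerre polynomial in Hille-Hardy. -/
theorem choose_div_gamma {a : ℝ} (ha : -1 < a) {n j : ℕ} (h : j ≤ n) :
    (n.choose j : ℝ) / Real.Gamma (j + a + 1) =
      n.factorial / Real.Gamma (n + a + 1) * laguerreCoeff n a j := by
  have h2 := gamma_pos ha j
  have h3 := gamma_pos ha n
  rw [Nat.cast_choose ℝ h, laguerreCoeff]
  field_simp

/-- The Hille-Hardy formula. -/
theorem hasSum_hille_hardy {a w : ℝ} (ha : -1 < a) (hw : 0 ≤ w) (hw1 : w < 1) (x y : ℝ) :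
    HasSum (fun n : ℕ =>
        n.factorial / Real.Gamma (n + a + 1) * (laguerre n a x * laguerre n a y) * w ^ n)
      ((1 - w) ^ (-a - 1) * Real.exp (-(x + y) * w / (1 - w)) *
        besselSeries a (x * y * w / (1 - w) ^ 2)) := by
  have h1 : 0 < 1 - w := by linarith
  -- `L_n(y)` is expanded in powers of `-y`. The sum over `n` at fixed `j` is the `j`-th Taylor
  -- coefficient at `w`; the sum over `j` is then `hasSum_laguerre_div_gamma`.
  have inner : ∀ x y : ℝ, ∀ j : ℕ, HasSum (fun n : ℕ =>
      (n.choose j : ℝ) * ((-y) ^ j / Real.Gamma (j + a + 1)) * (laguerre n a x * w ^ n))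
        ((1 - w) ^ (-a - 1) * Real.exp (-x * w / (1 - w)) *
          (laguerre j a (x / (1 - w)) * (-y * w / (1 - w)) ^ j / Real.Gamma (j + a + 1))) := by
    intro x y j
    refine hasSum_of_eq ((hasSum_choose_mul_laguerre ha hw hw1 x j).mul_left
      ((-y) ^ j * w ^ j / Real.Gamma (j + a + 1))) (fun n => ?_) ?_
    · rcases lt_or_ge n j with hn | hn
      · simp [Nat.choose_eq_zero_of_lt hn]
      · obtain ⟨m, rfl⟩ := Nat.exists_eq_add_of_le hn
        rw [Nat.add_sub_cancel_left, pow_add]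
        ring
    · rw [div_pow, mul_pow]
      ring
  have outer : ∀ x y : ℝ, HasSum (fun j : ℕ => (1 - w) ^ (-a - 1) * Real.exp (-x * w / (1 - w)) *
      (laguerre j a (x / (1 - w)) * (-y * w / (1 - w)) ^ j / Real.Gamma (j + a + 1)))
      ((1 - w) ^ (-a - 1) * Real.exp (-(x + y) * w / (1 - w)) *
        besselSeries a (x * y * w / (1 - w) ^ 2)) := by
    intro x y
    refine hasSum_of_eq ((hasSum_laguerre_div_gamma ha (x / (1 - w)) (-y * w / (1 - w))).mul_left _)
      (fun _ => rfl) ?_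
    have e1 : -(x + y) * w / (1 - w) = -x * w / (1 - w) + -y * w / (1 - w) := by ring
    have e2 : -(x / (1 - w)) * (-y * w / (1 - w)) = x * y * w / (1 - w) ^ 2 := by
      field_simp
    rw [e1, Real.exp_add, e2]
    ring
  have hs : Summable (fun p : ℕ × ℕ => ((p.2.choose p.1 : ℕ) : ℝ) *
      ((-y) ^ p.1 / Real.Gamma (p.1 + a + 1)) * (laguerre p.2 a x * w ^ p.2)) := by
    -- The same series at `-|x|`, `-|y|` has nonnegative terms and dominates.
    have hs' := summable_prod_of_hasSum (f := fun j n => ((n.choose j : ℕ) : ℝ) *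
        ((-(-|y|)) ^ j / Real.Gamma (j + a + 1)) * (laguerre n a (-|x|) * w ^ n))
      (fun j n => by
        have := gamma_pos ha j
        have := laguerre_neg_abs_nonneg ha n x
        rw [neg_neg]
        positivity) (inner (-|x|) (-|y|)) (outer _ _).summable
    refine Summable.of_norm_bounded hs' fun p => ?_
    have := gamma_pos ha p.1
    rw [norm_mul, norm_mul, norm_mul, norm_div, norm_pow, norm_pow, norm_neg, neg_neg,
      Real.norm_of_nonneg this.le, Real.norm_of_nonneg hw, Real.norm_natCast]
    simp only [Real.norm_eq_abs]
    gcongr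
    exact abs_laguerre_le ha _ _
  refine hasSum_swap (f := fun j n => ((n.choose j : ℕ) : ℝ) *
      ((-y) ^ j / Real.Gamma (j + a + 1)) * (laguerre n a x * w ^ n)) hs (inner x y) (outer x y)
      fun n => ?_
  refine hasSum_of_eq (hasSum_sum_of_ne_finset_zero (f := fun j : ℕ => (n.choose j : ℝ) *
    ((-y) ^ j / Real.Gamma (j + a + 1)) * (laguerre n a x * w ^ n)) (s := Finset.range (n + 1))
    fun j hj => ?_) (fun _ => rfl) ?_
  · rw [Nat.choose_eq_zero_of_lt (by simpa using hj)]
    simp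
  · rw [laguerre_eq_sum n a y]
    simp only [Finset.mul_sum, Finset.sum_mul]
    refine Finset.sum_congr rfl fun j hj => ?_
    have := choose_div_gamma ha (Nat.lt_succ_iff.1 (Finset.mem_range.1 hj))
    rw [mul_div_left_comm, this]
    ring

/-! ### The measure and integrals of product functions. -/

variable {d : ℕ}

theorem measurableSet_orthant : MeasurableSet (orthant d) := by
  have : orthant d = ⋂ i, (fun x : Fin d → ℝ => x i) ⁻¹' Set.Ioi 0 := by
    ext x; simp [orthant]
  rw [this]
  exact MeasurableSet.iInter fun i => measurable_pi_apply i measurableSet_Ioi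

theorem measurable_weight (α : Fin d → ℝ) :
    Measurable (fun x : Fin d → ℝ => ∏ i, x i ^ (2 * α i + 1)) :=
  Finset.measurable_prod _ fun i _ => (measurable_pi_apply i).pow_const _

instance (α : Fin d → ℝ) : SigmaFinite (measure α) := by
  unfold measure
  infer_instance

theorem ae_mem_orthant (α : Fin d → ℝ) : ∀ᵐ x ∂(measure α), x ∈ orthant d :=
  (withDensity_absolutelyContinuous _ _).ae_le (ae_restrict_mem measurableSet_orthant)

theorem weight_nonneg (α : Fin d → ℝ) {x : Fin d → ℝ} (hx : x ∈ orthant d) :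
    0 ≤ ∏ i, x i ^ (2 * α i + 1) :=
  Finset.prod_nonneg fun i _ => Real.rpow_nonneg (hx i).le _

/-- Turns integrals over the orthant into integrals over all of `ℝ^d`, where Fubini for products
applies. -/
theorem indicator_orthant_prod (f : Fin d → ℝ → ℝ) (x : Fin d → ℝ) :
    (orthant d).indicator (fun x => ∏ i, f i (x i)) x =
      ∏ i, (Set.Ioi (0 : ℝ)).indicator (f i) (x i) := by
  by_cases hx : x ∈ orthant d
  · rw [Set.indicator_of_mem hx]
    exact Finset.prod_congr rfl fun i _ => (Set.indicator_of_mem (hx i) _).symm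
  · rw [Set.indicator_of_notMem hx]
    obtain ⟨i, hi⟩ : ∃ i, ¬ 0 < x i := by simpa [orthant] using hx
    exact (Finset.prod_eq_zero (Finset.mem_univ i) (Set.indicator_of_notMem hi _)).symm

theorem weight_smul_ae_eq (α : Fin d → ℝ) (f : Fin d → ℝ → ℝ) :
    (fun x : Fin d → ℝ => (ENNReal.ofReal (∏ i, x i ^ (2 * α i + 1))).toReal • ∏ i, f i (x i))
      =ᵐ[volume.restrict (orthant d)] fun x => ∏ i, (x i ^ (2 * α i + 1) * f i (x i)) := by
  filter_upwards [ae_restrict_mem measurableSet_orthant] with x hx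
  rw [ENNReal.toReal_ofReal (weight_nonneg α hx), smul_eq_mul, Finset.prod_mul_distrib]

theorem integral_prod_measure (α : Fin d → ℝ) (f : Fin d → ℝ → ℝ) :
    ∫ x, ∏ i, f i (x i) ∂(measure α) =
      ∏ i, ∫ x in Set.Ioi (0 : ℝ), x ^ (2 * α i + 1) * f i x := by
  rw [measure, integral_withDensity_eq_integral_toReal_smul (measurable_weight α).ennreal_ofReal
    (Eventually.of_forall fun _ => ENNReal.ofReal_lt_top),
    integral_congr_ae (weight_smul_ae_eq α f), ← integral_indicator measurableSet_orthant]
  simp only [← integral_indicator (measurableSet_Ioi (a := (0 : ℝ)))]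
  rw [← integral_fintype_prod_volume_eq_prod]
  refine integral_congr_ae (Eventually.of_forall fun x => ?_)
  exact indicator_orthant_prod (fun i s => s ^ (2 * α i + 1) * f i s) x

theorem integrable_prod_measure (α : Fin d → ℝ) {f : Fin d → ℝ → ℝ}
    (hf : ∀ i, IntegrableOn (fun x => x ^ (2 * α i + 1) * f i x) (Set.Ioi 0)) :
    Integrable (fun x : Fin d → ℝ => ∏ i, f i (x i)) (measure α) := by
  rw [measure, integrable_withDensity_iff_integrable_smul' (measurable_weight α).ennreal_ofReal
    (Eventually.of_forall fun _ => ENNReal.ofReal_lt_top),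
    integrable_congr (weight_smul_ae_eq α f)]
  change IntegrableOn _ _ _
  rw [← integrable_indicator_iff measurableSet_orthant]
  have h : Integrable (fun x : Fin d → ℝ => ∏ i, (Set.Ioi (0 : ℝ)).indicator
      (fun x => x ^ (2 * α i + 1) * f i x) (x i)) (Measure.pi fun _ => volume) :=
    Integrable.fintype_prod fun i =>
      (integrable_indicator_iff measurableSet_Ioi).2 (hf i)
  refine h.congr (Eventually.of_forall fun x => ?_)
  exact (indicator_orthant_prod (fun i s => s ^ (2 * α i + 1) * f i s) x).symm

/-! ### Gaussian moments and orthonormality. -/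

theorem rpow_mul_sq_pow {x : ℝ} (hx : 0 < x) (a : ℝ) (p : ℕ) :
    x ^ (2 * a + 1) * (x ^ 2) ^ p = x ^ (2 * (p + a) + 1) := by
  rw [← pow_mul, ← Real.rpow_natCast, ← Real.rpow_add hx]
  congr 1
  push_cast
  ring

theorem integrableOn_gaussian_moment {a c : ℝ} (ha : -1 < a) (hc : 0 < c) (p : ℕ) :
    IntegrableOn (fun x : ℝ => x ^ (2 * a + 1) * ((x ^ 2) ^ p * Real.exp (-c * x ^ 2)))
      (Set.Ioi 0) := by
  have hp : (0 : ℝ) ≤ p := p.cast_nonneg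
  refine (integrableOn_rpow_mul_exp_neg_mul_sq hc (s := 2 * (p + a) + 1)
    (by linarith)).congr_fun (fun x hx => ?_) measurableSet_Ioi
  simp only
  rw [← mul_assoc, rpow_mul_sq_pow hx]

theorem integral_gaussian_moment {a c : ℝ} (ha : -1 < a) (hc : 0 < c) (p : ℕ) :
    ∫ x in Set.Ioi (0 : ℝ), x ^ (2 * a + 1) * ((x ^ 2) ^ p * Real.exp (-c * x ^ 2)) =
      Real.Gamma (p + a + 1) / 2 * c ^ (-(p + a + 1)) := by
  have hp : (0 : ℝ) ≤ p := p.cast_nonneg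
  have h := integral_rpow_mul_exp_neg_mul_rpow (p := 2) (q := 2 * (p + a) + 1) (b := c) two_pos
    (by linarith) hc
  have e : (2 * (p + a) + 1 + 1) / 2 = p + a + 1 := by ring
  rw [neg_div, e] at h
  rw [show Real.Gamma (p + a + 1) / 2 * c ^ (-(p + a + 1)) =
    c ^ (-(p + a + 1)) * (1 / 2) * Real.Gamma (p + a + 1) by ring, ← h]
  refine setIntegral_congr_fun measurableSet_Ioi fun x hx => ?_
  rw [← mul_assoc, rpow_mul_sq_pow hx, Real.rpow_two]

theorem gamma_add_eq_ascPochhammer {b : ℝ} (hb : 0 < b) (j : ℕ) :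
    Real.Gamma (b + j) = (ascPochhammer ℝ j).eval b * Real.Gamma b := by
  induction j with
  | zero => simp
  | succ j ih =>
    rw [Nat.cast_succ, ← add_assoc, Real.Gamma_add_one (by positivity), ih, ascPochhammer_succ_eval]
    ring

/-- Up to a factor the sum is the `n`-th finite difference at `a + 1` of the rising factorial of
degree `j`: zero for `j < n`, and `n!` for `j = n` since that polynomial is monic. -/
theorem sum_laguerreCoeff_mul_gamma {a : ℝ} (ha : -1 < a) {n j : ℕ} (hj : j ≤ n) :
    ∑ i ∈ Finset.range (n + 1), laguerreCoeff n a i * (-1) ^ i * Real.Gamma ((i + j : ℕ) + a + 1) =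
      if j = n then (-1) ^ n * Real.Gamma (n + a + 1) else 0 := by
  set P : Polynomial ℝ := ascPochhammer ℝ j with hP
  have hdeg : P.natDegree = j := ascPochhammer_natDegree ℝ j
  have h1 := fwdDiff_iter_eq_sum_shift (h := (1 : ℝ)) P.eval n (a + 1)
  have h2 : (fwdDiff (1 : ℝ))^[n] P.eval (a + 1) = if j = n then (n.factorial : ℝ) else 0 := by
    split_ifs with h
    · have h3 := P.fwdDiff_iter_degree_eq_factorial
      rw [hdeg, h] at h3
      rw [h3, (monic_ascPochhammer ℝ j).leadingCoeff]
      simp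
    · rw [Polynomial.fwdDiff_iter_eq_zero_of_degree_lt (by omega)]
      rfl
  have e : ∀ i ∈ Finset.range (n + 1),
      laguerreCoeff n a i * (-1) ^ i * Real.Gamma ((i + j : ℕ) + a + 1) =
      (-1) ^ n * Real.Gamma (n + a + 1) / n.factorial *
        (((-1 : ℤ) ^ (n - i) * n.choose i) • P.eval (a + 1 + i • (1 : ℝ))) := by
    intro i hi
    have hi' : i ≤ n := Nat.lt_succ_iff.1 (Finset.mem_range.1 hi)
    have hb : 0 < (i : ℝ) + a + 1 := by have : (0 : ℝ) ≤ i := i.cast_nonneg; linarith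
    have e1 : ((i + j : ℕ) : ℝ) + a + 1 = (i + a + 1) + j := by push_cast; ring
    have e2 : a + 1 + i • (1 : ℝ) = i + a + 1 := by simp; ring
    have e3 : ((-1 : ℝ)) ^ n = (-1) ^ (n - i) * (-1) ^ i := by
      rw [← pow_add, Nat.sub_add_cancel hi']
    have e4 : ((-1 : ℝ)) ^ (n - i) * (-1) ^ (n - i) = 1 := by
      rw [← mul_pow]; simp
    have := gamma_pos ha i
    rw [e1, gamma_add_eq_ascPochhammer hb, e2, zsmul_eq_mul, e3]
    push_cast
    rw [Nat.cast_choose ℝ hi', laguerreCoeff]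
    have h5 : (n.factorial : ℝ) ≠ 0 := by positivity
    field_simp
    rw [pow_two, e4, hP, mul_one]
  rw [Finset.sum_congr rfl e, ← Finset.mul_sum, ← h1, h2]
  split_ifs
  · field_simp
  · simp

theorem laguerre_mul_laguerre_eq_sum (m n : ℕ) (a x : ℝ) :
    laguerre m a x * laguerre n a x =
      ∑ j ∈ Finset.range (m + 1), ∑ i ∈ Finset.range (n + 1),
        laguerreCoeff m a j * (-1) ^ j * (laguerreCoeff n a i * (-1) ^ i) * x ^ (i + j) := by
  rw [laguerre_eq_sum, laguerre_eq_sum, Finset.sum_mul_sum]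
  refine Finset.sum_congr rfl fun j _ => Finset.sum_congr rfl fun i _ => ?_
  rw [neg_pow x, neg_pow x, pow_add]
  ring

theorem weight_laguerre_mul_laguerre (m n : ℕ) (a x : ℝ) :
    x ^ (2 * a + 1) * (laguerre m a (x ^ 2) * laguerre n a (x ^ 2) * Real.exp (-x ^ 2)) =
      ∑ j ∈ Finset.range (m + 1), ∑ i ∈ Finset.range (n + 1),
        laguerreCoeff m a j * (-1) ^ j * (laguerreCoeff n a i * (-1) ^ i) *
          (x ^ (2 * a + 1) * ((x ^ 2) ^ (i + j) * Real.exp (-1 * x ^ 2))) := by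
  rw [laguerre_mul_laguerre_eq_sum]
  simp only [Finset.mul_sum, Finset.sum_mul]
  refine Finset.sum_congr rfl fun j _ => Finset.sum_congr rfl fun i _ => ?_
  rw [neg_one_mul]
  ring

theorem integrableOn_laguerre_mul_laguerre {a : ℝ} (ha : -1 < a) (m n : ℕ) :
    IntegrableOn (fun x : ℝ => x ^ (2 * a + 1) *
      (laguerre m a (x ^ 2) * laguerre n a (x ^ 2) * Real.exp (-x ^ 2))) (Set.Ioi 0) := by
  simp only [weight_laguerre_mul_laguerre]
  exact integrable_finsetSum _ fun j _ => integrable_finsetSum _ fun i _ =>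
    (integrableOn_gaussian_moment ha one_pos (i + j)).const_mul _

/-- Each power `x^{2j}` of the lower-degree factor is tested against `L_n`; only `j = m = n` can
survive. -/
theorem integral_laguerre_mul_laguerre_of_le {a : ℝ} (ha : -1 < a) {m n : ℕ} (hmn : m ≤ n) :
    ∫ x in Set.Ioi (0 : ℝ), x ^ (2 * a + 1) *
      (laguerre m a (x ^ 2) * laguerre n a (x ^ 2) * Real.exp (-x ^ 2)) =
      if m = n then Real.Gamma (n + a + 1) / (2 * n.factorial) else 0 := by
  simp only [weight_laguerre_mul_laguerre]
  rw [integral_finsetSum _ fun j _ => integrable_finsetSum _ fun i _ =>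
    (integrableOn_gaussian_moment ha one_pos (i + j)).const_mul _]
  have h : ∀ j ∈ Finset.range (m + 1), ∫ x in Set.Ioi (0 : ℝ), ∑ i ∈ Finset.range (n + 1),
        laguerreCoeff m a j * (-1) ^ j * (laguerreCoeff n a i * (-1) ^ i) *
          (x ^ (2 * a + 1) * ((x ^ 2) ^ (i + j) * Real.exp (-1 * x ^ 2))) =
      laguerreCoeff m a j * (-1) ^ j / 2 *
        if j = n then (-1) ^ n * Real.Gamma (n + a + 1) else 0 := by
    intro j hj
    have hj' : j ≤ m := Nat.lt_succ_iff.1 (Finset.mem_range.1 hj)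
    rw [integral_finsetSum _ fun i _ =>
      (integrableOn_gaussian_moment ha one_pos (i + j)).const_mul _,
      ← sum_laguerreCoeff_mul_gamma ha (hj'.trans hmn), Finset.mul_sum]
    refine Finset.sum_congr rfl fun i _ => ?_
    rw [integral_const_mul, integral_gaussian_moment ha one_pos, Real.one_rpow]
    ring
  rw [Finset.sum_congr rfl h]
  split_ifs with hm
  · subst hm
    rw [Finset.sum_eq_single m (fun j _ hj => by simp [hj]) (by simp)]
    have e4 : ((-1 : ℝ)) ^ m * (-1) ^ m = 1 := by rw [← mul_pow]; simp
    have := gamma_pos ha m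
    rw [if_pos rfl, laguerreCoeff, Nat.sub_self, Nat.factorial_zero]
    push_cast
    have h5 : (m.factorial : ℝ) ≠ 0 := by positivity
    field_simp
    rw [pow_two, e4]
  · refine Finset.sum_eq_zero fun j hj => ?_
    have hj' : j ≤ m := Nat.lt_succ_iff.1 (Finset.mem_range.1 hj)
    rw [if_neg (by omega), mul_zero]

theorem integral_laguerre_mul_laguerre {a : ℝ} (ha : -1 < a) (m n : ℕ) :
    ∫ x in Set.Ioi (0 : ℝ), x ^ (2 * a + 1) *
      (laguerre m a (x ^ 2) * laguerre n a (x ^ 2) * Real.exp (-x ^ 2)) =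
      if m = n then Real.Gamma (n + a + 1) / (2 * n.factorial) else 0 := by
  rcases le_total m n with h | h
  · exact integral_laguerre_mul_laguerre_of_le ha h
  · simp only [mul_comm (laguerre m a _)]
    rw [integral_laguerre_mul_laguerre_of_le ha h]
    by_cases hmn : m = n
    · subst hmn; simp
    · rw [if_neg (Ne.symm hmn), if_neg hmn]

/-- The normalising constant of the Laguerre functions. -/
def normConst (n : ℕ) (a : ℝ) : ℝ := √2 * √(Real.Gamma (n + 1) / Real.Gamma (n + a + 1))

theorem ell1_eq (n : ℕ) (a x : ℝ) :
    ell1 n a x = normConst n a * laguerre n a (x ^ 2) * Real.exp (-x ^ 2 / 2) := rfl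

theorem normConst_pos {a : ℝ} (ha : -1 < a) (n : ℕ) : 0 < normConst n a := by
  have h1 := gamma_pos ha n
  have h2 : 0 < Real.Gamma (n + 1) := Real.Gamma_pos_of_pos (by positivity)
  exact mul_pos (by positivity) (Real.sqrt_pos.2 (div_pos h2 h1))

theorem normConst_mul_self {a : ℝ} (ha : -1 < a) (n : ℕ) :
    normConst n a * normConst n a = 2 * (n.factorial / Real.Gamma (n + a + 1)) := by
  have h1 := gamma_pos ha n
  rw [normConst, Real.Gamma_nat_eq_factorial, mul_mul_mul_comm, Real.mul_self_sqrt (by norm_num),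
    Real.mul_self_sqrt (by positivity)]

theorem ell1_mul_ell1 (m n : ℕ) (a x : ℝ) :
    ell1 m a x * ell1 n a x = normConst m a * normConst n a *
      (laguerre m a (x ^ 2) * laguerre n a (x ^ 2) * Real.exp (-x ^ 2)) := by
  have : Real.exp (-x ^ 2) = Real.exp (-x ^ 2 / 2) * Real.exp (-x ^ 2 / 2) := by
    rw [← Real.exp_add]; ring_nf
  rw [this, ell1_eq, ell1_eq]
  ring

theorem integrableOn_ell1_mul_ell1 {a : ℝ} (ha : -1 < a) (m n : ℕ) :
    IntegrableOn (fun x : ℝ => x ^ (2 * a + 1) * (ell1 m a x * ell1 n a x)) (Set.Ioi 0) := by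
  simp only [ell1_mul_ell1, mul_left_comm _ (normConst m a * normConst n a)]
  exact (integrableOn_laguerre_mul_laguerre ha m n).const_mul _

theorem integral_ell1_mul_ell1 {a : ℝ} (ha : -1 < a) (m n : ℕ) :
    ∫ x in Set.Ioi (0 : ℝ), x ^ (2 * a + 1) * (ell1 m a x * ell1 n a x) =
      if m = n then 1 else 0 := by
  simp only [ell1_mul_ell1, mul_left_comm _ (normConst m a * normConst n a)]
  rw [integral_const_mul, integral_laguerre_mul_laguerre ha]
  split_ifs with h
  · subst h
    have h1 := gamma_pos ha m
    have h5 : (m.factorial : ℝ) ≠ 0 := by positivity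
    rw [normConst_mul_self ha]
    field_simp
  · simp

theorem continuous_laguerre (n : ℕ) (a : ℝ) : Continuous (laguerre n a) := by
  unfold laguerre
  fun_prop

theorem continuous_ell1 (n : ℕ) (a : ℝ) : Continuous (ell1 n a) := by
  have := continuous_laguerre n a
  unfold ell1
  fun_prop

theorem continuous_ell (α : Fin d → ℝ) (k : Fin d → ℕ) : Continuous (ell α k) :=
  continuous_finsetProd _ fun i _ => (continuous_ell1 _ _).comp (continuous_apply i)

theorem ell_mul_ell (α : Fin d → ℝ) (j k : Fin d → ℕ) (x : Fin d → ℝ) :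
    ell α j x * ell α k x = ∏ i, ell1 (j i) (α i) (x i) * ell1 (k i) (α i) (x i) :=
  Finset.prod_mul_distrib.symm

variable {α : Fin d → ℝ}

theorem integrable_ell_mul_ell (hα : ∀ i, -1 < α i) (j k : Fin d → ℕ) :
    Integrable (fun x => ell α j x * ell α k x) (measure α) := by
  simp only [ell_mul_ell]
  exact integrable_prod_measure α (f := fun i s => ell1 (j i) (α i) s * ell1 (k i) (α i) s)
    fun i => integrableOn_ell1_mul_ell1 (hα i) _ _

theorem integral_ell_mul_ell (hα : ∀ i, -1 < α i) (j k : Fin d → ℕ) :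
    ∫ x, ell α j x * ell α k x ∂(measure α) = if j = k then 1 else 0 := by
  simp only [ell_mul_ell]
  rw [integral_prod_measure α (fun i s => ell1 (j i) (α i) s * ell1 (k i) (α i) s)]
  simp only [fun i => integral_ell1_mul_ell1 (hα i)]
  split_ifs with h
  · subst h; simp
  · obtain ⟨i, hi⟩ := Function.ne_iff.1 h
    exact Finset.prod_eq_zero (Finset.mem_univ i) (if_neg hi)

theorem memLp_ell (hα : ∀ i, -1 < α i) (k : Fin d → ℕ) : MemLp (ell α k) 2 (measure α) := by
  rw [memLp_two_iff_integrable_sq (continuous_ell α k).aestronglyMeasurable]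
  simpa only [pow_two] using integrable_ell_mul_ell hα k k

/-! ### The one-dimensional heat kernel. -/

/-- The one-dimensional heat kernel in closed form. -/
def heatKernel1 (a t x y : ℝ) : ℝ :=
  2 * (2 * Real.sinh (2 * t)) ^ (-a - 1) *
    Real.exp (-(Real.cosh (2 * t) / (2 * Real.sinh (2 * t))) * (x ^ 2 + y ^ 2)) *
    besselSeries a ((x * y / (2 * Real.sinh (2 * t))) ^ 2)

theorem besselSeries_nonneg {a : ℝ} (ha : -1 < a) {z : ℝ} (hz : 0 ≤ z) : 0 ≤ besselSeries a z :=
  tsum_nonneg fun m => by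
    have := gamma_pos ha m
    positivity

/-- The Bessel series has positive coefficients and is evaluated at a square, so no sign condition
on `x`, `y` is needed. -/
theorem heatKernel1_nonneg {a t : ℝ} (ha : -1 < a) (ht : 0 < t) (x y : ℝ) :
    0 ≤ heatKernel1 a t x y := by
  have h1 : 0 < Real.sinh (2 * t) := Real.sinh_pos_iff.2 (by linarith)
  have h2 := besselSeries_nonneg ha (sq_nonneg (x * y / (2 * Real.sinh (2 * t))))
  unfold heatKernel1
  positivity

/-- The extra factorial makes the growth slower than any exponential: comparing with the series of
`exp(ε s)`, the ratios of coefficients are terms of a convergent series, hence bounded by its sum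
`M`. -/
theorem exists_besselSeries_le {a : ℝ} (ha : -1 < a) {B ε : ℝ} (hB : 0 ≤ B) (hε : 0 < ε) :
    ∃ M, ∀ s, 0 ≤ s → besselSeries a (B * s) ≤ M * Real.exp (ε * s) := by
  have h := summable_pow_div_gamma ha (B / ε)
  refine ⟨∑' m : ℕ, (B / ε) ^ m / Real.Gamma (m + a + 1), fun s hs => ?_⟩
  have hE := NormedSpace.expSeries_div_hasSum_exp (ε * s)
  rw [← Real.exp_eq_exp_ℝ] at hE
  refine hasSum_le (fun m => ?_) (hasSum_besselSeries ha (B * s)) (hE.mul_left _)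
  have hG := gamma_pos ha m
  have h2 : (B / ε) ^ m / Real.Gamma (m + a + 1) ≤
      ∑' m : ℕ, (B / ε) ^ m / Real.Gamma (m + a + 1) :=
    h.le_tsum m fun j _ => by have := gamma_pos ha j; positivity
  calc (B * s) ^ m / (m.factorial * Real.Gamma (m + a + 1))
      = (B / ε) ^ m / Real.Gamma (m + a + 1) * ((ε * s) ^ m / m.factorial) := by
        rw [mul_pow, mul_pow, div_pow]; field_simp
    _ ≤ _ := mul_le_mul_of_nonneg_right h2 (by positivity)

theorem exists_heatKernel1_le {a t : ℝ} (ha : -1 < a) (ht : 0 < t) (x : ℝ) :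
    ∃ M, ∀ y, heatKernel1 a t x y ≤ M := by
  have hS : 0 < Real.sinh (2 * t) := Real.sinh_pos_iff.2 (by linarith)
  have hC : 0 < Real.cosh (2 * t) := Real.cosh_pos _
  set c := Real.cosh (2 * t) / (2 * Real.sinh (2 * t)) with hc
  have hc0 : 0 < c := by positivity
  -- The rate `ε = c` is chosen so that the growth exactly cancels the Gaussian in `y`.
  obtain ⟨M, hM⟩ := exists_besselSeries_le ha (sq_nonneg (x / (2 * Real.sinh (2 * t)))) hc0
  refine ⟨2 * (2 * Real.sinh (2 * t)) ^ (-a - 1) * Real.exp (-c * x ^ 2) * M, fun y => ?_⟩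
  have e : (x * y / (2 * Real.sinh (2 * t))) ^ 2 = (x / (2 * Real.sinh (2 * t))) ^ 2 * y ^ 2 := by
    ring
  rw [heatKernel1, ← hc, e]
  calc _ ≤ 2 * (2 * Real.sinh (2 * t)) ^ (-a - 1) * Real.exp (-c * (x ^ 2 + y ^ 2)) *
        (M * Real.exp (c * y ^ 2)) :=
        mul_le_mul_of_nonneg_left (hM _ (sq_nonneg y)) (by positivity)
    _ = 2 * (2 * Real.sinh (2 * t)) ^ (-a - 1) * Real.exp (-c * x ^ 2) * M := by
        have : Real.exp (-c * x ^ 2) = Real.exp (-c * (x ^ 2 + y ^ 2)) * Real.exp (c * y ^ 2) := by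
          rw [← Real.exp_add]; ring_nf
        rw [this]
        ring

theorem one_sub_exp_neg (t : ℝ) :
    1 - Real.exp (-4 * t) = Real.exp (-2 * t) * (2 * Real.sinh (2 * t)) := by
  rw [Real.sinh_eq]
  have h1 : Real.exp (-4 * t) = Real.exp (-2 * t) * Real.exp (-(2 * t)) := by
    rw [← Real.exp_add]; ring_nf
  have h2 : Real.exp (-2 * t) * Real.exp (2 * t) = 1 := by
    rw [← Real.exp_add]; simp
  rw [h1]
  linear_combination -h2

/-- Hille-Hardy at `w = e^{-4t}` with arguments `x²`, `y²`. Here `1 - w = 2 e^{-2t} sinh 2t`, and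
`1/2 + w/(1 - w) = coth(2t)/2` gives the Gaussian rate. -/
theorem hasSum_heatKernel1 {a t : ℝ} (ha : -1 < a) (ht : 0 < t) (x y : ℝ) :
    HasSum (fun n : ℕ => Real.exp (-t * (4 * n + 2 * a + 2)) * (ell1 n a x * ell1 n a y))
      (heatKernel1 a t x y) := by
  have hS : 0 < Real.sinh (2 * t) := Real.sinh_pos_iff.2 (by linarith)
  have hw1 : Real.exp (-4 * t) < 1 := Real.exp_lt_one_iff.2 (by linarith)
  have h := (hasSum_hille_hardy ha (Real.exp_pos (-4 * t)).le hw1 (x ^ 2) (y ^ 2)).mul_left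
    (2 * Real.exp (-t * (2 * a + 2)) * Real.exp (-(x ^ 2 + y ^ 2) / 2))
  refine hasSum_of_eq h (fun n => ?_) ?_
  · have e1 : Real.exp (-t * (4 * n + 2 * a + 2)) =
        Real.exp (-t * (2 * a + 2)) * Real.exp (-4 * t) ^ n := by
      rw [← Real.exp_nat_mul, ← Real.exp_add]; ring_nf
    have e2 : Real.exp (-(x ^ 2 + y ^ 2) / 2) =
        Real.exp (-x ^ 2 / 2) * Real.exp (-y ^ 2 / 2) := by
      rw [← Real.exp_add]; ring_nf
    rw [e1, e2, ell1_eq, ell1_eq]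
    linear_combination Real.exp (-t * (2 * a + 2)) * Real.exp (-4 * t) ^ n * laguerre n a (x ^ 2) *
      laguerre n a (y ^ 2) * Real.exp (-x ^ 2 / 2) * Real.exp (-y ^ 2 / 2) *
      normConst_mul_self ha n
  · have hE := Real.exp_pos (-2 * t)
    have e1 : Real.exp (-4 * t) = Real.exp (-2 * t) * Real.exp (-2 * t) := by
      rw [← Real.exp_add]; ring_nf
    have e2 : Real.exp (-t * (2 * a + 2)) = Real.exp (-2 * t) ^ (a + 1) := by
      rw [← Real.exp_mul]; ring_nf
    have e3 : Real.exp (-2 * t) ^ (a + 1) * Real.exp (-2 * t) ^ (-a - 1) = 1 := by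
      rw [← Real.rpow_add hE]; simp
    have e4 : x ^ 2 * y ^ 2 * Real.exp (-4 * t) / (1 - Real.exp (-4 * t)) ^ 2 =
        (x * y / (2 * Real.sinh (2 * t))) ^ 2 := by
      rw [one_sub_exp_neg, e1]; field_simp
    have e5 : -(Real.cosh (2 * t) / (2 * Real.sinh (2 * t))) * (x ^ 2 + y ^ 2) =
        -(x ^ 2 + y ^ 2) / 2 + -(x ^ 2 + y ^ 2) * Real.exp (-4 * t) / (1 - Real.exp (-4 * t)) := by
      have e6 : Real.cosh (2 * t) = Real.sinh (2 * t) + Real.exp (-2 * t) := by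
        rw [Real.cosh_eq, Real.sinh_eq]; ring_nf
      rw [one_sub_exp_neg, e1, e6]
      field_simp
      ring
    rw [heatKernel1, e5, Real.exp_add, e4, one_sub_exp_neg, e2,
      Real.mul_rpow hE.le (by positivity)]
    linear_combination -(2 * (2 * Real.sinh (2 * t)) ^ (-a - 1) *
      Real.exp (-(x ^ 2 + y ^ 2) / 2) *
      Real.exp (-(x ^ 2 + y ^ 2) * Real.exp (-4 * t) / (Real.exp (-2 * t) * (2 * Real.sinh (2 * t))))
      * besselSeries a ((x * y / (2 * Real.sinh (2 * t))) ^ 2)) * e3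

/-- Integrated term by term against Gaussian moments, the Gamma factors of the Bessel series cancel
and an exponential series in `x² / (2 sinh 2t cosh 2t)` remains. The exponents combine to the
hyperbolic tangent through `cosh² - sinh² = 1`. -/
theorem integral_heatKernel1 {a t : ℝ} (ha : -1 < a) (ht : 0 < t) (x : ℝ) :
    ∫ y in Set.Ioi (0 : ℝ), y ^ (2 * a + 1) * heatKernel1 a t x y =
      Real.cosh (2 * t) ^ (-a - 1) * Real.exp (-(x ^ 2 * Real.tanh (2 * t)) / 2) := by
  have hS : 0 < Real.sinh (2 * t) := Real.sinh_pos_iff.2 (by linarith)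
  have hC : 0 < Real.cosh (2 * t) := Real.cosh_pos _
  set S := Real.sinh (2 * t) with hSdef
  set C := Real.cosh (2 * t) with hCdef
  have hSC : C ^ 2 = S ^ 2 + 1 := by
    have := Real.cosh_sq (2 * t); linarith
  set c := C / (2 * S) with hc
  have hc0 : 0 < c := by positivity
  set F : ℕ → ℝ → ℝ := fun m y =>
    2 * (2 * S) ^ (-a - 1) * Real.exp (-c * x ^ 2) *
      ((x / (2 * S)) ^ 2) ^ m / (m.factorial * Real.Gamma (m + a + 1)) *
      (y ^ (2 * a + 1) * ((y ^ 2) ^ m * Real.exp (-c * y ^ 2))) with hF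
  have hFi : ∀ m, IntegrableOn (F m) (Set.Ioi 0) := fun m =>
    (integrableOn_gaussian_moment ha hc0 m).const_mul _
  have hFint : ∀ m, ∫ y in Set.Ioi (0 : ℝ), F m y =
      C ^ (-a - 1) * Real.exp (-c * x ^ 2) *
        ((x ^ 2 / (2 * S * C)) ^ m / m.factorial) := fun m => by
    have hG := gamma_pos ha m
    have e1 : c ^ (-((m : ℝ) + a + 1)) = (C ^ (-a - 1) / (2 * S) ^ (-a - 1)) / c ^ m := by
      rw [show -((m : ℝ) + a + 1) = (-a - 1) - m by ring, Real.rpow_sub hc0 (-a - 1),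
        Real.rpow_natCast, hc, Real.div_rpow hC.le (by positivity)]
    have e2 : x ^ 2 / (2 * S * C) = (x / (2 * S)) ^ 2 / c := by
      rw [hc]; field_simp
    have h0 : (2 * S) ^ (-a - 1) ≠ 0 := (Real.rpow_pos_of_pos (by positivity) _).ne'
    rw [hF]
    simp only
    rw [integral_const_mul, integral_gaussian_moment ha hc0, e1, e2, div_pow _ c]
    generalize (x / (2 * S)) ^ 2 = B
    field_simp
  have hFn : ∀ m, ∫ y in Set.Ioi (0 : ℝ), ‖F m y‖ = ∫ y in Set.Ioi (0 : ℝ), F m y := fun m => by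
    refine setIntegral_congr_fun measurableSet_Ioi fun y hy => Real.norm_of_nonneg ?_
    have hy' : (0 : ℝ) < y := hy
    have hG := gamma_pos ha m
    simp only [hF]
    positivity
  have hE := NormedSpace.expSeries_div_hasSum_exp (x ^ 2 / (2 * S * C))
  rw [← Real.exp_eq_exp_ℝ] at hE
  have hE' := hE.mul_left (C ^ (-a - 1) * Real.exp (-c * x ^ 2))
  have h := hasSum_integral_of_summable_integral_norm hFi (by
    simp only [hFn, hFint]
    exact hE'.summable)
  simp only [hFint] at h
  have e := h.unique hE'
  have e3 : -c * x ^ 2 + x ^ 2 / (2 * S * C) = -(x ^ 2 * Real.tanh (2 * t)) / 2 := by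
    rw [Real.tanh_eq_sinh_div_cosh, ← hSdef, ← hCdef, hc]
    field_simp
    linear_combination -x ^ 2 * hSC
  rw [mul_assoc, ← Real.exp_add, e3] at e
  rw [← e]
  refine setIntegral_congr_fun measurableSet_Ioi fun y _ => ?_
  have hB := (hasSum_besselSeries ha ((x * y / (2 * S)) ^ 2)).mul_left
    (y ^ (2 * a + 1) * (2 * (2 * S) ^ (-a - 1) * Real.exp (-c * (x ^ 2 + y ^ 2))))
  have e4 : y ^ (2 * a + 1) * heatKernel1 a t x y = y ^ (2 * a + 1) *
      (2 * (2 * S) ^ (-a - 1) * Real.exp (-c * (x ^ 2 + y ^ 2))) *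
      besselSeries a ((x * y / (2 * S)) ^ 2) := by
    rw [heatKernel1, ← hSdef, ← hCdef, ← hc]; ring
  rw [e4, ← hB.tsum_eq]
  refine tsum_congr fun m => ?_
  have hG := gamma_pos ha m
  have e5 : Real.exp (-c * (x ^ 2 + y ^ 2)) = Real.exp (-c * x ^ 2) * Real.exp (-c * y ^ 2) := by
    rw [← Real.exp_add]; ring_nf
  have e6 : ((x * y / (2 * S)) ^ 2) ^ m = ((x / (2 * S)) ^ 2) ^ m * (y ^ 2) ^ m := by
    rw [← mul_pow]; ring_nf
  rw [hF, e5, e6]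
  ring

/-- The integral of a non-integrable function is zero by convention, whereas the computed value is
positive. -/
theorem integrableOn_heatKernel1 {a t : ℝ} (ha : -1 < a) (ht : 0 < t) (x : ℝ) :
    IntegrableOn (fun y => y ^ (2 * a + 1) * heatKernel1 a t x y) (Set.Ioi 0) := by
  by_contra h
  have h1 := integral_undef h
  rw [integral_heatKernel1 ha ht] at h1
  have : 0 < Real.cosh (2 * t) ^ (-a - 1) * Real.exp (-(x ^ 2 * Real.tanh (2 * t)) / 2) :=
    mul_pos (Real.rpow_pos_of_pos (Real.cosh_pos _) _) (Real.exp_pos _)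
  exact this.ne' h1

theorem summable_exp_eigenvalue1 (a : ℝ) {t : ℝ} (ht : 0 < t) :
    Summable (fun n : ℕ => Real.exp (-t * (4 * n + 2 * a + 2))) := by
  have h : Summable (fun n : ℕ => Real.exp (-t * (2 * a + 2)) * Real.exp (-4 * t) ^ n) :=
    (summable_geometric_of_lt_one (Real.exp_pos _).le
      (Real.exp_lt_one_iff.2 (by linarith))).mul_left _
  refine h.congr fun n => ?_
  rw [← Real.exp_nat_mul, ← Real.exp_add]
  ring_nf

/-- From `|u| ≤ 1 + u²` and convergence of the kernel series on the diagonal. -/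
theorem summable_exp_mul_abs_ell1 {a t : ℝ} (ha : -1 < a) (ht : 0 < t) (x : ℝ) :
    Summable (fun n : ℕ => Real.exp (-t * (4 * n + 2 * a + 2)) * |ell1 n a x|) := by
  refine Summable.of_nonneg_of_le (fun n => by positivity) (fun n => ?_)
    ((summable_exp_eigenvalue1 a ht).add (hasSum_heatKernel1 ha ht x x).summable)
  rw [← mul_one_add]
  refine mul_le_mul_of_nonneg_left ?_ (Real.exp_pos _).le
  nlinarith [sq_nonneg (|ell1 n a x| - 1), abs_mul_abs_self (ell1 n a x), abs_nonneg (ell1 n a x)]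

theorem summable_exp_mul_abs_ell1_mul {a t : ℝ} (ha : -1 < a) (ht : 0 < t) (x y : ℝ) :
    Summable (fun n : ℕ => |Real.exp (-t * (4 * n + 2 * a + 2)) * (ell1 n a x * ell1 n a y)|) :=
  (hasSum_heatKernel1 ha ht x y).summable.abs

/-- With `v = 1 / normConst n a` one has `v ≤ 1 + 2 v²`, and `2 v² = Γ(n + a + 1) / n!` is the
coefficient of a binomial series. -/
theorem summable_pow_div_normConst {a w : ℝ} (ha : -1 < a) (hw : 0 ≤ w) (hw1 : w < 1) :
    Summable (fun n : ℕ => w ^ n / normConst n a) := by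
  have h := (hasSum_gamma_mul_pow (b := a + 1) (by linarith)
    (by rwa [abs_of_nonneg hw] : |w| < 1)).summable
  refine Summable.of_nonneg_of_le (fun n => ?_) (fun n => ?_)
    ((summable_geometric_of_lt_one hw hw1).add h)
  · have := normConst_pos ha n
    positivity
  · have h1 := normConst_pos ha n
    have h2 := normConst_mul_self ha n
    have hG := gamma_pos ha n
    have h5 : (0 : ℝ) < n.factorial := by positivity
    have e : Real.Gamma (n + (a + 1)) / n.factorial = 2 * (1 / normConst n a) ^ 2 := by
      rw [div_pow, pow_two (normConst n a), h2, ← add_assoc]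
      field_simp
    rw [e]
    have h3 : 1 / normConst n a ≤ 1 + 2 * (1 / normConst n a) ^ 2 := by
      nlinarith [sq_nonneg (1 / normConst n a - 1)]
    calc w ^ n / normConst n a = w ^ n * (1 / normConst n a) := by ring
      _ ≤ w ^ n * (1 + 2 * (1 / normConst n a) ^ 2) := mul_le_mul_of_nonneg_left h3 (by positivity)
      _ = _ := by ring

/-! Series indexed by multi-indices. -/

/-- Induction on `d`, splitting off the first index. Absolute summability is carried along because
multiplying two series requires it. -/
theorem hasSum_and_summable_prod {d : ℕ} (f : Fin d → ℕ → ℝ) (hf : ∀ i, Summable fun n => |f i n|) :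
    (Summable fun k : Fin d → ℕ => |∏ i, f i (k i)|) ∧
      HasSum (fun k : Fin d → ℕ => ∏ i, f i (k i)) (∏ i, ∑' n, f i n) := by
  induction d with
  | zero =>
    refine ⟨(hasSum_fintype _).summable, ?_⟩
    simp
  | succ d ih =>
    obtain ⟨h1, h2⟩ := ih (fun i => f i.succ) fun i => hf i.succ
    have e : ∀ p : ℕ × (Fin d → ℕ), ∏ i, f i ((Fin.consEquiv fun _ => ℕ) p i) =
        f 0 p.1 * ∏ i, f (Fin.succ i) (p.2 i) := fun p => by
      simp [Fin.prod_univ_succ, Fin.consEquiv]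
    have h3 : Summable fun p : ℕ × (Fin d → ℕ) => |f 0 p.1 * ∏ i, f (Fin.succ i) (p.2 i)| := by
      simp only [abs_mul]
      exact (hf 0).mul_of_nonneg h1 (fun _ => abs_nonneg _) fun _ => abs_nonneg _
    constructor
    · rw [← (Fin.consEquiv fun _ => ℕ).summable_iff]
      refine h3.congr fun p => ?_
      simp only [Function.comp, e]
    · rw [← (Fin.consEquiv fun _ => ℕ).hasSum_iff, Fin.prod_univ_succ, ← h2.tsum_eq]
      have h4 := (Summable.of_abs (hf 0)).hasSum.mul (Summable.of_abs h1).hasSum h3.of_abs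
      refine hasSum_of_eq h4 (fun p => ?_) rfl
      simp only [Function.comp, e]

/-! ### The kernel in dimension `d`: mass, bounds and Chapman-Kolmogorov. -/

variable {t : ℝ}

theorem exp_eigenvalue_eq_prod (α : Fin d → ℝ) (k : Fin d → ℕ) (t : ℝ) :
    Real.exp (-t * eigenvalue α k) = ∏ i, Real.exp (-t * (4 * k i + 2 * α i + 2)) := by
  rw [← Real.exp_sum, ← Finset.mul_sum, eigenvalue, Finset.sum_add_distrib, Finset.sum_add_distrib,
    ← Finset.mul_sum, ← Finset.mul_sum]
  simp [mul_comm]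

theorem kernel_term_eq_prod (α : Fin d → ℝ) (t : ℝ) (k : Fin d → ℕ) (x y : Fin d → ℝ) :
    Real.exp (-t * eigenvalue α k) * (ell α k x * ell α k y) =
      ∏ i, Real.exp (-t * (4 * k i + 2 * α i + 2)) *
        (ell1 (k i) (α i) (x i) * ell1 (k i) (α i) (y i)) := by
  rw [exp_eigenvalue_eq_prod, ell, ell, ← Finset.prod_mul_distrib, ← Finset.prod_mul_distrib]

theorem hasSum_kernel_prod (hα : ∀ i, -1 < α i) (ht : 0 < t) (x y : Fin d → ℝ) :
    HasSum (fun k : Fin d → ℕ => Real.exp (-t * eigenvalue α k) * (ell α k x * ell α k y))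
      (∏ i, heatKernel1 (α i) t (x i) (y i)) := by
  have h := (hasSum_and_summable_prod
    (fun i n => Real.exp (-t * (4 * n + 2 * α i + 2)) *
      (ell1 n (α i) (x i) * ell1 n (α i) (y i)))
    fun i => summable_exp_mul_abs_ell1_mul (hα i) ht (x i) (y i)).2
  refine hasSum_of_eq h (fun k => kernel_term_eq_prod α t k x y) ?_
  exact Finset.prod_congr rfl fun i _ => (hasSum_heatKernel1 (hα i) ht _ _).tsum_eq.symm

theorem kernel_eq_prod (hα : ∀ i, -1 < α i) (ht : 0 < t) (x y : Fin d → ℝ) :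
    kernel α t x y = ∏ i, heatKernel1 (α i) t (x i) (y i) :=
  (hasSum_kernel_prod hα ht x y).tsum_eq

theorem hasSum_kernel (hα : ∀ i, -1 < α i) (ht : 0 < t) (x y : Fin d → ℝ) :
    HasSum (fun k : Fin d → ℕ => Real.exp (-t * eigenvalue α k) * (ell α k x * ell α k y))
      (kernel α t x y) := by
  rw [kernel_eq_prod hα ht]
  exact hasSum_kernel_prod hα ht x y

theorem kernel_nonneg (hα : ∀ i, -1 < α i) (ht : 0 < t) (x y : Fin d → ℝ) :
    0 ≤ kernel α t x y := by
  rw [kernel_eq_prod hα ht]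
  exact Finset.prod_nonneg fun i _ => heatKernel1_nonneg (hα i) ht _ _

theorem kernel_symm (α : Fin d → ℝ) (t : ℝ) (x y : Fin d → ℝ) :
    kernel α t x y = kernel α t y x := by
  simp only [kernel, mul_comm (ell α _ x)]

theorem measurable_kernel (hα : ∀ i, -1 < α i) (ht : 0 < t) :
    Measurable (fun p : (Fin d → ℝ) × (Fin d → ℝ) => kernel α t p.1 p.2) := by
  refine measurable_of_tendsto_metrizable' (u := (atTop : Filter (Finset (Fin d → ℕ))))
    (f := fun s p => ∑ k ∈ s, Real.exp (-t * eigenvalue α k) * (ell α k p.1 * ell α k p.2))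
    (fun s => ?_) ?_
  · refine Finset.measurable_sum _ fun k _ => ?_
    have := (continuous_ell α k).measurable
    fun_prop
  · exact tendsto_pi_nhds.2 fun p => hasSum_kernel hα ht p.1 p.2

theorem measurable_kernel_right (hα : ∀ i, -1 < α i) (ht : 0 < t) (x : Fin d → ℝ) :
    Measurable (kernel α t x) := by
  have h : Measurable fun y : Fin d → ℝ => (x, y) := measurable_prodMk_left
  have h2 := (measurable_kernel hα ht).comp h
  simpa only [Function.comp_def] using h2

theorem exists_kernel_le (hα : ∀ i, -1 < α i) (ht : 0 < t) (x : Fin d → ℝ) :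
    ∃ M, ∀ y, kernel α t x y ≤ M := by
  choose M hM using fun i => exists_heatKernel1_le (hα i) ht (x i)
  refine ⟨∏ i, M i, fun y => ?_⟩
  rw [kernel_eq_prod hα ht]
  exact Finset.prod_le_prod (fun i _ => heatKernel1_nonneg (hα i) ht _ _) fun i _ => hM i (y i)

theorem integrable_kernel (hα : ∀ i, -1 < α i) (ht : 0 < t) (x : Fin d → ℝ) :
    Integrable (kernel α t x) (measure α) := by
  have h := integrable_prod_measure α (f := fun i s => heatKernel1 (α i) t (x i) s)
    fun i => integrableOn_heatKernel1 (hα i) ht (x i)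
  exact h.congr (Eventually.of_forall fun y => (kernel_eq_prod hα ht x y).symm)

theorem integral_kernel (hα : ∀ i, -1 < α i) (ht : 0 < t) (x : Fin d → ℝ) :
    ∫ y, kernel α t x y ∂(measure α) = ∏ i, (Real.cosh (2 * t) ^ (-α i - 1) *
      Real.exp (-(x i ^ 2 * Real.tanh (2 * t)) / 2)) := by
  simp only [kernel_eq_prod hα ht]
  rw [integral_prod_measure α (fun i s => heatKernel1 (α i) t (x i) s)]
  exact Finset.prod_congr rfl fun i _ => integral_heatKernel1 (hα i) ht (x i)

theorem prod_cosh_rpow (α : Fin d → ℝ) (t : ℝ) :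
    ∏ i, Real.cosh (2 * t) ^ (-α i - 1) = Real.cosh (2 * t) ^ (-(∑ i, α i + d)) := by
  rw [← Real.rpow_sum_of_pos (Real.cosh_pos _)]
  congr 1
  rw [Finset.sum_sub_distrib, Finset.sum_neg_distrib]
  simp
  ring

/-- The Gaussian factors are at most one since `tanh 2t ≥ 0`. This bound, uniform in `x`, is the
constant of the theorem. -/
theorem integral_kernel_le (hα : ∀ i, -1 < α i) (ht : 0 < t) (x : Fin d → ℝ) :
    ∫ y, kernel α t x y ∂(measure α) ≤ Real.cosh (2 * t) ^ (-(∑ i, α i + d)) := by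
  rw [integral_kernel hα ht, ← prod_cosh_rpow]
  have h1 : 0 ≤ Real.tanh (2 * t) := by
    rw [Real.tanh_eq_sinh_div_cosh]
    exact div_nonneg (Real.sinh_nonneg_iff.2 (by linarith)) (Real.cosh_pos _).le
  have hc := Real.cosh_pos (2 * t)
  refine Finset.prod_le_prod (fun i _ => by positivity) fun i _ => ?_
  refine mul_le_of_le_one_right (by positivity) (Real.exp_le_one_iff.2 ?_)
  have : 0 ≤ x i ^ 2 * Real.tanh (2 * t) := by positivity
  linarith

theorem add_card_pos (hd : 1 ≤ d) (hα : ∀ i, -1 < α i) : 0 < ∑ i, α i + d := by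
  have : ∑ i : Fin d, (α i + 1) = ∑ i, α i + d := by
    rw [Finset.sum_add_distrib]; simp
  rw [← this]
  have : Nonempty (Fin d) := ⟨⟨0, hd⟩⟩
  exact Finset.sum_pos (fun i _ => by linarith [hα i]) Finset.univ_nonempty

theorem cosh_rpow_lt_one (hd : 1 ≤ d) (hα : ∀ i, -1 < α i) (ht : 0 < t) :
    Real.cosh (2 * t) ^ (-(∑ i, α i + d)) < 1 :=
  Real.rpow_lt_one_of_one_lt_of_neg (Real.one_lt_cosh.2 (by positivity))
    (neg_neg_of_pos (add_card_pos hd hα))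

theorem lintegral_enorm_kernel_le (hα : ∀ i, -1 < α i) (ht : 0 < t) (x : Fin d → ℝ) :
    ∫⁻ y, ‖kernel α t x y‖ₑ ∂(measure α) ≤
      ENNReal.ofReal (Real.cosh (2 * t) ^ (-(∑ i, α i + d))) := by
  simp only [Real.enorm_of_nonneg (kernel_nonneg hα ht x _)]
  rw [← ofReal_integral_eq_lintegral_ofReal (integrable_kernel hα ht x)
    (Eventually.of_forall fun y => kernel_nonneg hα ht x y)]
  exact ENNReal.ofReal_le_ofReal (integral_kernel_le hα ht x)

/-- Bounded and integrable, hence square integrable. -/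
theorem memLp_kernel (hα : ∀ i, -1 < α i) (ht : 0 < t) (x : Fin d → ℝ) :
    MemLp (kernel α t x) 2 (measure α) := by
  obtain ⟨M, hM⟩ := exists_kernel_le hα ht x
  rw [memLp_two_iff_integrable_sq (measurable_kernel_right hα ht x).aestronglyMeasurable]
  refine Integrable.mono' ((integrable_kernel hα ht x).const_mul M)
    ((measurable_kernel_right hα ht x).pow_const 2).aestronglyMeasurable
    (Eventually.of_forall fun y => ?_)
  have h0 := kernel_nonneg hα ht x y
  rw [Real.norm_of_nonneg (sq_nonneg _), pow_two]
  exact mul_le_mul_of_nonneg_right (hM y) h0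

theorem summable_exp_mul_abs_ell (hα : ∀ i, -1 < α i) (ht : 0 < t) (x : Fin d → ℝ) :
    Summable (fun k : Fin d → ℕ => Real.exp (-t * eigenvalue α k) * |ell α k x|) := by
  have h := (hasSum_and_summable_prod
    (fun i n => Real.exp (-t * (4 * n + 2 * α i + 2)) * |ell1 n (α i) (x i)|)
    fun i => (summable_exp_mul_abs_ell1 (hα i) ht (x i)).abs).2.summable
  refine h.congr fun k => ?_
  rw [Finset.prod_mul_distrib, exp_eigenvalue_eq_prod, ell, Finset.abs_prod]

/-- A bound independent of `k`, from `|uv| ≤ u² + v²` and the normalisation of `ℓ_k`; it justifies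
exchanging sums over `k` with integrals. -/
theorem integral_abs_ell_mul_le (hα : ∀ i, -1 < α i) (k : Fin d → ℕ) {g : (Fin d → ℝ) → ℝ}
    (hg : MemLp g 2 (measure α)) :
    ∫ z, |ell α k z * g z| ∂(measure α) ≤ 1 + ∫ z, g z ^ 2 ∂(measure α) := by
  have h1 : ∫ z, ell α k z ^ 2 ∂(measure α) = 1 := by
    simpa [pow_two] using integral_ell_mul_ell hα k k
  have h2 := (memLp_ell hα k).integrable_sq
  have h3 := hg.integrable_sq
  rw [← h1, ← integral_add h2 h3]
  refine integral_mono ((memLp_ell hα k).integrable_mul hg).abs (h2.add h3) fun z => ?_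
  simp only [abs_mul]
  nlinarith [sq_nonneg (|ell α k z| - |g z|), sq_abs (ell α k z), sq_abs (g z)]

theorem hasSum_integral_kernel_mul (hα : ∀ i, -1 < α i) (ht : 0 < t) (x : Fin d → ℝ)
    {g : (Fin d → ℝ) → ℝ} (hg : MemLp g 2 (measure α)) :
    HasSum (fun k : Fin d → ℕ => Real.exp (-t * eigenvalue α k) * ell α k x *
      ∫ z, ell α k z * g z ∂(measure α)) (∫ z, kernel α t x z * g z ∂(measure α)) := by
  have hF : ∀ k : Fin d → ℕ, Integrable
      (fun z => Real.exp (-t * eigenvalue α k) * ell α k x * (ell α k z * g z)) (measure α) :=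
    fun k => ((memLp_ell hα k).integrable_mul hg).const_mul _
  have h := hasSum_integral_of_summable_integral_norm hF ?_
  · refine hasSum_of_eq h (fun k => (integral_const_mul _ _).symm) ?_
    refine integral_congr_ae (Eventually.of_forall fun z => ?_)
    have := ((hasSum_kernel hα ht x z).mul_right (g z)).tsum_eq
    simp only
    rw [← this]
    exact tsum_congr fun k => by ring
  · refine Summable.of_nonneg_of_le (fun k => integral_nonneg fun _ => norm_nonneg _) (fun k => ?_)
      ((summable_exp_mul_abs_ell hα ht x).mul_right (1 + ∫ z, g z ^ 2 ∂(measure α)))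
    simp only [norm_mul (Real.exp (-t * eigenvalue α k) * ell α k x)]
    rw [integral_const_mul, norm_mul, Real.norm_of_nonneg (Real.exp_pos _).le]
    exact mul_le_mul_of_nonneg_left (integral_abs_ell_mul_le hα k hg) (by positivity)

theorem integral_kernel_mul_ell (hα : ∀ i, -1 < α i) (ht : 0 < t) (x : Fin d → ℝ)
    (j : Fin d → ℕ) :
    ∫ z, kernel α t x z * ell α j z ∂(measure α) =
      Real.exp (-t * eigenvalue α j) * ell α j x := by
  have h := hasSum_integral_kernel_mul hα ht x (memLp_ell hα j)
  refine h.unique ?_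
  simp only [integral_ell_mul_ell hα]
  refine hasSum_of_eq (hasSum_ite_eq j (Real.exp (-t * eigenvalue α j) * ell α j x))
    (fun k => ?_) rfl
  split_ifs with hk
  · rw [hk, mul_one]
  · rw [mul_zero]

/-- The Chapman-Kolmogorov identity. -/
theorem integral_kernel_mul_kernel (hα : ∀ i, -1 < α i) {s : ℝ} (hs : 0 < s) (ht : 0 < t)
    (x y : Fin d → ℝ) :
    ∫ z, kernel α s x z * kernel α t z y ∂(measure α) = kernel α (s + t) x y := by
  simp only [kernel_symm α t _ y]
  -- The kernel at time `t` is itself in `L²`, with coefficients `e^{-tλ_k} ℓ_k(y)`; the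
  -- exponentials then multiply.
  refine (hasSum_integral_kernel_mul hα hs x (memLp_kernel hα ht y)).unique ?_
  refine hasSum_of_eq (hasSum_kernel hα (add_pos hs ht) x y) (fun k => ?_) rfl
  have e : Real.exp (-(s + t) * eigenvalue α k) =
      Real.exp (-s * eigenvalue α k) * Real.exp (-t * eigenvalue α k) := by
    rw [← Real.exp_add]; ring_nf
  simp only [mul_comm (ell α k _) (kernel α t y _)]
  rw [integral_kernel_mul_ell hα ht, e]
  ring

/-! ### Completeness of the Laguerre functions. -/

theorem hasSum_ell1_generating {a w : ℝ} (ha : -1 < a) (hw : 0 ≤ w) (hw1 : w < 1) (x : ℝ) :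
    (Summable fun n : ℕ => |w ^ n / normConst n a * ell1 n a x|) ∧
    HasSum (fun n : ℕ => w ^ n / normConst n a * ell1 n a x)
      ((1 - w) ^ (-a - 1) * Real.exp (-x ^ 2 * w / (1 - w)) * Real.exp (-x ^ 2 / 2)) := by
  have e : ∀ n : ℕ, w ^ n / normConst n a * ell1 n a x =
      laguerre n a (x ^ 2) * w ^ n * Real.exp (-x ^ 2 / 2) := fun n => by
    have := normConst_pos ha n
    rw [ell1_eq]
    field_simp
  constructor
  · refine ((summable_abs_laguerre_mul_pow ha hw hw1 (x ^ 2)).mul_right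
      (Real.exp (-x ^ 2 / 2))).congr fun n => ?_
    rw [e, abs_mul, abs_mul, abs_of_nonneg (pow_nonneg hw n), Real.abs_exp]
  · exact hasSum_of_eq ((hasSum_laguerre_mul_pow ha (by rwa [abs_of_nonneg hw]) (x ^ 2)).mul_right
      (Real.exp (-x ^ 2 / 2))) e rfl

/-- The generating function writes each such product of Gaussians as an absolutely convergent
combination of the `ℓ_k`, all of which are orthogonal to `f`. -/
theorem integral_mul_gaussian_eq_zero (hα : ∀ i, -1 < α i) {f : (Fin d → ℝ) → ℝ}
    (hf : MemLp f 2 (measure α)) (h0 : ∀ k, ∫ x, ell α k x * f x ∂(measure α) = 0)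
    (m : Fin d → ℕ) :
    ∫ x, (∏ i, Real.exp (-x i ^ 2) ^ m i) * ((∏ i, Real.exp (-x i ^ 2 / 2)) * f x)
      ∂(measure α) = 0 := by
  -- Chosen so that `w / (1 - w) = m`, the rate in the generating function.
  set w : Fin d → ℝ := fun i => m i / (1 + m i) with hw
  have hw0 : ∀ i, 0 ≤ w i := fun i => by positivity
  have hw1 : ∀ i, w i < 1 := fun i => by
    rw [hw, div_lt_one (by positivity)]; linarith
  set c : (Fin d → ℕ) → ℝ := fun k => ∏ i, w i ^ k i / normConst (k i) (α i) with hc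
  set C : ℝ := ∏ i, (1 - w i) ^ (-α i - 1) with hC
  have hC0 : C ≠ 0 := (Finset.prod_pos fun i _ =>
    Real.rpow_pos_of_pos (by linarith [hw1 i]) _).ne'
  have hpt : ∀ x, HasSum (fun k => c k * ell α k x)
      (C * ((∏ i, Real.exp (-x i ^ 2) ^ m i) * ∏ i, Real.exp (-x i ^ 2 / 2))) := fun x => by
    have h := (hasSum_and_summable_prod
      (fun i n => w i ^ n / normConst n (α i) * ell1 n (α i) (x i))
      fun i => (hasSum_ell1_generating (hα i) (hw0 i) (hw1 i) (x i)).1).2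
    refine hasSum_of_eq h (fun k => ?_) ?_
    · rw [hc, ell, ← Finset.prod_mul_distrib]
    · simp only [fun i => (hasSum_ell1_generating (hα i) (hw0 i) (hw1 i) (x i)).2.tsum_eq]
      rw [hC, ← Finset.prod_mul_distrib, ← Finset.prod_mul_distrib]
      refine Finset.prod_congr rfl fun i _ => ?_
      have e : -x i ^ 2 * w i / (1 - w i) = m i * -x i ^ 2 := by
        have h1 : (1 + m i : ℝ) ≠ 0 := by positivity
        have h2 : 1 - w i = 1 / (1 + m i) := by rw [hw]; field_simp; ring
        rw [h2, hw]
        field_simp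
      rw [e, Real.exp_nat_mul, mul_assoc]
  have hcs : Summable fun k => |c k| :=
    (hasSum_and_summable_prod (fun i n => w i ^ n / normConst n (α i)) fun i =>
      (summable_pow_div_normConst (hα i) (hw0 i) (hw1 i)).abs).1
  have hF : ∀ k, Integrable (fun x => c k * (ell α k x * f x)) (measure α) := fun k =>
    ((memLp_ell hα k).integrable_mul hf).const_mul _
  have h := hasSum_integral_of_summable_integral_norm hF ?_
  · simp only [integral_const_mul, h0, mul_zero] at h
    have h1 := h.unique hasSum_zero
    have h2 : ∀ x, ∑' k, c k * (ell α k x * f x) =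
        C * ((∏ i, Real.exp (-x i ^ 2) ^ m i) * ((∏ i, Real.exp (-x i ^ 2 / 2)) * f x)) := fun x => by
      have := ((hpt x).mul_right (f x)).tsum_eq
      simp only [mul_assoc] at this
      exact this
    simp only [h2, integral_const_mul] at h1
    exact (mul_eq_zero.1 h1).resolve_left hC0
  · refine Summable.of_nonneg_of_le (fun k => integral_nonneg fun _ => norm_nonneg _) (fun k => ?_)
      (hcs.mul_right (1 + ∫ z, f z ^ 2 ∂(measure α)))
    simp only [norm_mul (c k)]
    rw [integral_const_mul]
    exact mul_le_mul_of_nonneg_left (integral_abs_ell_mul_le hα k hf) (norm_nonneg _)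

/-- A bounded injective continuous function on `ℝ` that equals `exp (-s ^ 2)` for `s ≥ 0`. -/
def gaussianEmbedding (s : ℝ) : ℝ := Real.exp (-(max s 0) ^ 2) + 1 - Real.exp (-(min s 0) ^ 2)

theorem gaussianEmbedding_of_nonneg {s : ℝ} (hs : 0 ≤ s) :
    gaussianEmbedding s = Real.exp (-s ^ 2) := by
  simp [gaussianEmbedding, hs]

theorem continuous_gaussianEmbedding : Continuous gaussianEmbedding := by
  unfold gaussianEmbedding
  fun_prop

theorem abs_gaussianEmbedding_le (s : ℝ) : |gaussianEmbedding s| ≤ 2 := by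
  have h1 := Real.exp_pos (-(max s 0) ^ 2)
  have h2 := Real.exp_pos (-(min s 0) ^ 2)
  have h3 : Real.exp (-(max s 0) ^ 2) ≤ 1 :=
    Real.exp_le_one_iff.2 (by nlinarith [sq_nonneg (max s 0)])
  have h4 : Real.exp (-(min s 0) ^ 2) ≤ 1 :=
    Real.exp_le_one_iff.2 (by nlinarith [sq_nonneg (min s 0)])
  rw [gaussianEmbedding, abs_le]
  constructor <;> linarith

/-- Injectivity on all of `ℝ` is needed to separate points; `exp(-s²)` alone would identify `s` with
`-s`. -/
theorem strictAnti_gaussianEmbedding : StrictAnti gaussianEmbedding := by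
  intro s t hst
  unfold gaussianEmbedding
  have hmax : max s 0 ≤ max t 0 := max_le_max_right 0 hst.le
  have hmin : min s 0 ≤ min t 0 := min_le_min_right 0 hst.le
  have h0 : 0 ≤ max s 0 := le_max_right _ _
  have h0' : min t 0 ≤ 0 := min_le_right _ _
  have h1 : Real.exp (-(max t 0) ^ 2) ≤ Real.exp (-(max s 0) ^ 2) :=
    Real.exp_le_exp.2 (by nlinarith)
  have h2 : Real.exp (-(min s 0) ^ 2) ≤ Real.exp (-(min t 0) ^ 2) :=
    Real.exp_le_exp.2 (by nlinarith)
  rcases le_or_gt t 0 with ht | ht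
  · have : Real.exp (-(min s 0) ^ 2) < Real.exp (-(min t 0) ^ 2) := by
      rw [min_eq_left ht, min_eq_left (hst.le.trans ht)]
      exact Real.exp_lt_exp.2 (by nlinarith)
    linarith
  · have : Real.exp (-(max t 0) ^ 2) < Real.exp (-(max s 0) ^ 2) := by
      refine Real.exp_lt_exp.2 ?_
      have : max s 0 < max t 0 := by rw [max_eq_left ht.le]; exact max_lt hst ht
      nlinarith
    linarith

open BoundedContinuousFunction in
/-- The coordinates of `ℝ^d` through `gaussianEmbedding`. -/
def gaussianCoord (i : Fin d) : (Fin d → ℝ) →ᵇ ℝ :=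
  BoundedContinuousFunction.ofNormedAddCommGroup (fun x => gaussianEmbedding (x i))
    (continuous_gaussianEmbedding.comp (continuous_apply i)) 2
    fun x => abs_gaussianEmbedding_le (x i)

theorem gaussianCoord_apply (i : Fin d) (x : Fin d → ℝ) :
    gaussianCoord i x = gaussianEmbedding (x i) := rfl

open BoundedContinuousFunction in
/-- The algebra generated by the functions `gaussianCoord i`. -/
def gaussianAlgebra (d : ℕ) : StarSubalgebra ℝ ((Fin d → ℝ) →ᵇ ℝ) where
  toSubalgebra := Algebra.adjoin ℝ (Set.range gaussianCoord)
  star_mem' := fun {f} hf => by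
    have : star f = f := by ext x; simp
    rw [this]
    exact hf

/-- The coordinate functions generate a separating algebra of bounded continuous functions, which
determines finite measures. Elements of the algebra are polynomials in the coordinates, so monomials
suffice. -/
theorem measure_ext_of_moments {P Q : Measure (Fin d → ℝ)} [IsFiniteMeasure P] [IsFiniteMeasure Q]
    (h : ∀ m : Fin d → ℕ, ∫ x, ∏ i, gaussianEmbedding (x i) ^ m i ∂P =
      ∫ x, ∏ i, gaussianEmbedding (x i) ^ m i ∂Q) : P = Q := by
  refine ext_of_forall_mem_subalgebra_integral_eq_of_polish (𝕜 := ℝ) (A := gaussianAlgebra d)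
    ?_ ?_
  · intro x y hxy
    obtain ⟨i, hi⟩ := Function.ne_iff.1 hxy
    refine ⟨fun x => gaussianEmbedding (x i), ⟨_, ⟨gaussianCoord i, ?_, rfl⟩, rfl⟩,
      fun h => hi (strictAnti_gaussianEmbedding.injective h)⟩
    exact Algebra.subset_adjoin ⟨i, rfl⟩
  · intro g hg
    have hg' : g ∈ Algebra.adjoin ℝ (Set.range (gaussianCoord (d := d))) := hg
    rw [Algebra.adjoin_range_eq_range_aeval] at hg'
    obtain ⟨p, rfl⟩ := hg'
    clear hg
    induction p using MvPolynomial.induction_on' with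
    | monomial m c =>
      have e : ∀ x, (MvPolynomial.aeval gaussianCoord (MvPolynomial.monomial m c)) x =
          c * ∏ i, gaussianEmbedding (x i) ^ m i := fun x => by
        rw [MvPolynomial.aeval_monomial, Finsupp.prod_fintype _ _ fun i => pow_zero _]
        simp [BoundedContinuousFunction.algebraMap_apply, gaussianCoord_apply]
      have e' : ∀ ν : Measure (Fin d → ℝ),
          ∫ x, (MvPolynomial.aeval gaussianCoord (MvPolynomial.monomial m c)) x ∂ν =
            c * ∫ x, ∏ i, gaussianEmbedding (x i) ^ m i ∂ν := fun ν => by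
        rw [← integral_const_mul]
        exact integral_congr_ae (Eventually.of_forall e)
      exact (e' P).trans ((congrArg (c * ·) (h m)).trans (e' Q).symm)
    | add p q hp hq =>
      have e' : ∀ (ν : Measure (Fin d → ℝ)) [IsFiniteMeasure ν],
          ∫ x, (MvPolynomial.aeval gaussianCoord (p + q)) x ∂ν =
            ∫ x, (MvPolynomial.aeval gaussianCoord p) x ∂ν +
            ∫ x, (MvPolynomial.aeval gaussianCoord q) x ∂ν := fun ν _ => by
        rw [map_add, ← integral_add (BoundedContinuousFunction.integrable ν _)
          (BoundedContinuousFunction.integrable ν _)]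
        rfl
      exact (e' P).trans ((congrArg₂ (· + ·) hp hq).trans (e' Q).symm)

/-- Let `ρ` be `f` times the Gaussian, which is a multiple of `ℓ_0`, so `ρ` is integrable. Its
positive and negative parts are densities of two finite measures with equal moments. These measures
coincide, which forces `ρ = 0`. -/
theorem ae_eq_zero_of_integral_ell_eq_zero (hα : ∀ i, -1 < α i) {f : (Fin d → ℝ) → ℝ}
    (hf : MemLp f 2 (measure α)) (h0 : ∀ k, ∫ x, ell α k x * f x ∂(measure α) = 0) :
    f =ᵐ[measure α] 0 := by
  set ρ : (Fin d → ℝ) → ℝ := fun x => (∏ i, Real.exp (-x i ^ 2 / 2)) * f x with hρ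
  have hρi : Integrable ρ (measure α) := by
    have hc : (∏ i, normConst 0 (α i)) ≠ 0 :=
      (Finset.prod_pos fun i _ => normConst_pos (hα i) 0).ne'
    refine (((memLp_ell hα 0).integrable_mul hf).const_mul (∏ i, normConst 0 (α i))⁻¹).congr
      (Eventually.of_forall fun x => ?_)
    have h1 : ell α 0 x = (∏ i, normConst 0 (α i)) * ∏ i, Real.exp (-x i ^ 2 / 2) := by
      rw [ell, ← Finset.prod_mul_distrib]
      refine Finset.prod_congr rfl fun i _ => ?_
      have hG : Real.Gamma (α i + 1) ≠ 0 := (Real.Gamma_pos_of_pos (by linarith [hα i])).ne'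
      have : laguerre 0 (α i) (x i ^ 2) = 1 := by
        simp [laguerre, hG]
      rw [Pi.zero_apply, ell1_eq, this, mul_one]
    simp only [hρ, Pi.mul_apply]
    rw [h1]
    field_simp
  have hρm : AEMeasurable ρ (measure α) := hρi.aemeasurable
  have hfin1 := isFiniteMeasure_withDensity_ofReal hρi.2
  have hfin2 := isFiniteMeasure_withDensity_ofReal hρi.neg.2
  have hb : ∀ m : Fin d → ℕ, ∃ C, ∀ x : Fin d → ℝ,
      ‖∏ i, gaussianEmbedding (x i) ^ m i‖ ≤ C := fun m => by
    refine ⟨∏ i, 2 ^ m i, fun x => ?_⟩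
    rw [norm_prod]
    refine Finset.prod_le_prod (fun i _ => norm_nonneg _) fun i _ => ?_
    rw [norm_pow]
    exact pow_le_pow_left₀ (norm_nonneg _) (abs_gaussianEmbedding_le _) _
  have hcont : ∀ m : Fin d → ℕ,
      Continuous fun x : Fin d → ℝ => ∏ i, gaussianEmbedding (x i) ^ m i := fun m =>
    continuous_finsetProd _ fun i _ =>
      (continuous_gaussianEmbedding.comp (continuous_apply i)).pow _
  have key : (measure α).withDensity (fun x => ENNReal.ofReal (ρ x)) =
      (measure α).withDensity (fun x => ENNReal.ofReal ((-ρ) x)) := by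
    refine measure_ext_of_moments fun m => ?_
    obtain ⟨C, hC⟩ := hb m
    rw [integral_withDensity_eq_integral_toReal_smul₀ hρm.ennreal_ofReal
        (Eventually.of_forall fun _ => ENNReal.ofReal_lt_top),
      integral_withDensity_eq_integral_toReal_smul₀ hρm.neg.ennreal_ofReal
        (Eventually.of_forall fun _ => ENNReal.ofReal_lt_top), ← sub_eq_zero, ← integral_sub]
    · rw [← integral_mul_gaussian_eq_zero hα hf h0 m]
      refine integral_congr_ae ?_
      filter_upwards [ae_mem_orthant α] with x hx
      have : ∏ i, gaussianEmbedding (x i) ^ m i = ∏ i, Real.exp (-x i ^ 2) ^ m i :=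
        Finset.prod_congr rfl fun i _ => by rw [gaussianEmbedding_of_nonneg (hx i).le]
      rw [this, ENNReal.toReal_ofReal', ENNReal.toReal_ofReal', ← sub_smul, Pi.neg_apply,
        max_zero_sub_max_neg_zero_eq_self, smul_eq_mul, mul_comm]
    · simp only [ENNReal.toReal_ofReal', smul_eq_mul]
      exact hρi.pos_part.mul_bdd (hcont m).aestronglyMeasurable (Eventually.of_forall hC)
    · simp only [ENNReal.toReal_ofReal', smul_eq_mul]
      exact hρi.neg.pos_part.mul_bdd (hcont m).aestronglyMeasurable (Eventually.of_forall hC)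
  rw [withDensity_eq_iff_of_sigmaFinite hρm.ennreal_ofReal hρm.neg.ennreal_ofReal] at key
  filter_upwards [key] with x hx
  have h1 : ρ x = 0 := by
    rw [Pi.neg_apply] at hx
    rcases le_total (ρ x) 0 with h | h
    · rw [ENNReal.ofReal_of_nonpos h] at hx
      have := ENNReal.ofReal_eq_zero.1 hx.symm
      linarith
    · rw [ENNReal.ofReal_of_nonpos (neg_nonpos.2 h)] at hx
      exact le_antisymm (ENNReal.ofReal_eq_zero.1 hx) h
  exact (mul_eq_zero.1 h1).resolve_left (Finset.prod_pos fun i _ => Real.exp_pos _).ne'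

/-! ### The Laguerre differential equation and the eigenfunction property. -/

/-- The Laguerre polynomial as an element of `ℝ[X]`. -/
def laguerrePoly (n : ℕ) (a : ℝ) : Polynomial ℝ :=
  ∑ j ∈ Finset.range (n + 1), Polynomial.monomial j (laguerreCoeff n a j * (-1) ^ j)

theorem eval_laguerrePoly (n : ℕ) (a x : ℝ) : (laguerrePoly n a).eval x = laguerre n a x := by
  rw [laguerrePoly, Polynomial.eval_finsetSum, laguerre_eq_sum]
  refine Finset.sum_congr rfl fun j _ => ?_
  rw [Polynomial.eval_monomial, neg_pow x]
  ring

theorem coeff_laguerrePoly (n : ℕ) (a : ℝ) (j : ℕ) :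
    (laguerrePoly n a).coeff j = if j ≤ n then laguerreCoeff n a j * (-1) ^ j else 0 := by
  rw [laguerrePoly, Polynomial.finsetSum_coeff]
  simp [Polynomial.coeff_monomial]

theorem laguerreCoeff_succ {a : ℝ} (ha : -1 < a) {n j : ℕ} (hj : j < n) :
    (j + 1) * (j + a + 1) * laguerreCoeff n a (j + 1) = (n - j) * laguerreCoeff n a j := by
  obtain ⟨m, rfl⟩ := Nat.exists_eq_add_of_lt hj
  have hG := gamma_pos ha j
  have hb : 0 < (j : ℝ) + a + 1 := by have : (0 : ℝ) ≤ j := j.cast_nonneg; linarith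
  have e : ((j + 1 : ℕ) : ℝ) + a + 1 = (j + a + 1) + 1 := by push_cast; ring
  have e1 : j + m + 1 - (j + 1) = m := by omega
  have e2 : j + m + 1 - j = m + 1 := by omega
  rw [laguerreCoeff, laguerreCoeff, e, Real.Gamma_add_one hb.ne', e1, e2, Nat.factorial_succ,
    Nat.factorial_succ]
  push_cast
  have h5 : (m.factorial : ℝ) ≠ 0 := by positivity
  have h6 : (j.factorial : ℝ) ≠ 0 := by positivity
  have h7 : (m : ℝ) + 1 ≠ 0 := by positivity
  field_simp
  ring

/-- Comparing coefficients of `X^j` leaves the two-term recursion of `laguerreCoeff_succ`; at `j =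
n` the factor `n - j` ends it. -/
theorem laguerrePoly_ode {a : ℝ} (ha : -1 < a) (n : ℕ) :
    Polynomial.X * (laguerrePoly n a).derivative.derivative +
      (Polynomial.C (a + 1) - Polynomial.X) * (laguerrePoly n a).derivative +
      Polynomial.C (n : ℝ) * laguerrePoly n a = 0 := by
  ext j
  have hc : ∀ j : ℕ, ((j : ℝ) + 1) * (j + a + 1) * (laguerrePoly n a).coeff (j + 1) =
      -(n - j) * (laguerrePoly n a).coeff j := fun j => by
    rw [coeff_laguerrePoly, coeff_laguerrePoly]
    rcases lt_trichotomy j n with h | h | h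
    · rw [if_pos (by omega), if_pos h.le, pow_succ]
      linear_combination -(-1) ^ j * laguerreCoeff_succ ha h
    · subst h; simp
    · rw [if_neg (by omega), if_neg (by omega)]; simp
  rcases j with _ | j
  · have := hc 0
    simp only [Polynomial.coeff_add, Polynomial.mul_coeff_zero, Polynomial.coeff_X_zero, sub_mul,
      Polynomial.coeff_sub, Polynomial.coeff_C_zero, Polynomial.coeff_derivative,
      Polynomial.coeff_zero]
    push_cast at this ⊢
    linear_combination this
  · have := hc (j + 1)
    simp only [Polynomial.coeff_add, Polynomial.coeff_X_mul, sub_mul,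
      Polynomial.coeff_sub, Polynomial.coeff_C_mul, Polynomial.coeff_derivative,
      Polynomial.coeff_zero]
    push_cast at this ⊢
    linear_combination this

theorem hasDerivAt_poly_gaussian (p : Polynomial ℝ) (κ x : ℝ) :
    HasDerivAt (fun x => κ * p.eval (x ^ 2) * Real.exp (-x ^ 2 / 2))
      (κ * (2 * x * p.derivative.eval (x ^ 2) - x * p.eval (x ^ 2)) * Real.exp (-x ^ 2 / 2)) x := by
  have h1 : HasDerivAt (fun x : ℝ => x ^ 2) (2 * x) x := by simpa using hasDerivAt_pow 2 x
  have h2 : HasDerivAt (fun x : ℝ => p.eval (x ^ 2)) (p.derivative.eval (x ^ 2) * (2 * x)) x :=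
    HasDerivAt.comp (h₂ := fun z => p.eval z) x (p.hasDerivAt (x ^ 2)) h1
  have h3 : HasDerivAt (fun x : ℝ => Real.exp (-x ^ 2 / 2))
      (Real.exp (-x ^ 2 / 2) * (-(2 * x) / 2)) x := (h1.fun_neg.div_const 2).exp
  refine ((h2.const_mul κ).mul h3).congr_deriv ?_
  ring

theorem ell1_eq_poly (n : ℕ) (a : ℝ) : ell1 n a =
    fun x => normConst n a * (laguerrePoly n a).eval (x ^ 2) * Real.exp (-x ^ 2 / 2) := by
  ext x
  rw [ell1_eq, eval_laguerrePoly]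

theorem deriv_ell1 (n : ℕ) (a : ℝ) : deriv (ell1 n a) = fun x =>
    normConst n a * (2 * x * (laguerrePoly n a).derivative.eval (x ^ 2) -
      x * (laguerrePoly n a).eval (x ^ 2)) * Real.exp (-x ^ 2 / 2) := by
  ext x
  rw [ell1_eq_poly]
  exact (hasDerivAt_poly_gaussian _ _ x).deriv

theorem deriv_deriv_ell1 (n : ℕ) (a x : ℝ) : deriv (deriv (ell1 n a)) x =
    normConst n a * (4 * x ^ 2 * (laguerrePoly n a).derivative.derivative.eval (x ^ 2) +
      (2 - 4 * x ^ 2) * (laguerrePoly n a).derivative.eval (x ^ 2) +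
      (x ^ 2 - 1) * (laguerrePoly n a).eval (x ^ 2)) * Real.exp (-x ^ 2 / 2) := by
  rw [deriv_ell1]
  set p := laguerrePoly n a
  -- The first derivative is `x` times a function of the same form, with `2p' - p` in place of `p`,
  -- so the same rule applies again.
  have h := (hasDerivAt_id x).mul (hasDerivAt_poly_gaussian
    (Polynomial.C 2 * p.derivative - p) (normConst n a) x)
  have h' := h.deriv
  refine Eq.trans (congrArg (fun f => deriv f x) ?_) (h'.trans ?_)
  · ext y
    simp only [Pi.mul_apply, id, Polynomial.eval_sub, Polynomial.eval_mul, Polynomial.eval_C]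
    ring
  · simp only [id, Polynomial.eval_sub, Polynomial.eval_mul, Polynomial.eval_C,
      Polynomial.derivative_sub, Polynomial.derivative_mul, Polynomial.derivative_C, zero_mul,
      zero_add]
    ring

/-- After division by the Gaussian this is `-4` times Laguerre's equation at `x²`. -/
theorem ell1_eigen {a : ℝ} (ha : -1 < a) (n : ℕ) {x : ℝ} (hx : x ≠ 0) :
    -deriv (deriv (ell1 n a)) x + x ^ 2 * ell1 n a x - (2 * a + 1) / x * deriv (ell1 n a) x =
      (4 * n + 2 * a + 2) * ell1 n a x := by
  have h := congrArg (Polynomial.eval (x ^ 2)) (laguerrePoly_ode ha n)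
  simp only [Polynomial.eval_add, Polynomial.eval_mul, Polynomial.eval_sub, Polynomial.eval_X,
    Polynomial.eval_C, Polynomial.eval_zero] at h
  rw [deriv_deriv_ell1, deriv_ell1, ell1_eq_poly]
  simp only
  field_simp
  linear_combination -4 * normConst n a * h

theorem ell_update (α : Fin d → ℝ) (k : Fin d → ℕ) (x : Fin d → ℝ) (i : Fin d) (s : ℝ) :
    ell α k (Function.update x i s) = ell1 (k i) (α i) s *
      ∏ j ∈ Finset.univ.erase i, ell1 (k j) (α j) (x j) := by
  rw [ell, ← Finset.mul_prod_erase _ _ (Finset.mem_univ i), Function.update_self]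
  congr 1
  exact Finset.prod_congr rfl fun j hj => by rw [Function.update_of_ne (Finset.ne_of_mem_erase hj)]

theorem diffOp_ell (hα : ∀ i, -1 < α i) (k : Fin d → ℕ) {x : Fin d → ℝ} (hx : x ∈ orthant d) :
    diffOp α (ell α k) x = eigenvalue α k * ell α k x := by
  have hR : ∀ i, ell α k x = ell1 (k i) (α i) (x i) *
      ∏ j ∈ Finset.univ.erase i, ell1 (k j) (α j) (x j) := fun i => by
    rw [← ell_update, Function.update_eq_self]
  have e : ∀ i, -(deriv (deriv (ell1 (k i) (α i))) (x i) *
        ∏ j ∈ Finset.univ.erase i, ell1 (k j) (α j) (x j)) + x i ^ 2 * ell α k x -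
      (2 * α i + 1) / x i * (deriv (ell1 (k i) (α i)) (x i) *
        ∏ j ∈ Finset.univ.erase i, ell1 (k j) (α j) (x j)) =
      (4 * k i + 2 * α i + 2) * ell α k x := fun i => by
    rw [hR i]
    linear_combination (∏ j ∈ Finset.univ.erase i, ell1 (k j) (α j) (x j)) *
      ell1_eigen (hα i) (k i) (hx i).ne'
  have e2 : eigenvalue α k = ∑ i, (4 * (k i : ℝ) + 2 * α i + 2) := by
    rw [eigenvalue, Finset.sum_add_distrib, Finset.sum_add_distrib, ← Finset.mul_sum,
      ← Finset.mul_sum]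
    simp [mul_comm]
  rw [e2, Finset.sum_mul, ← Finset.sum_congr rfl fun i _ => e i, Finset.sum_sub_distrib,
    Finset.sum_add_distrib, Finset.sum_neg_distrib, ← Finset.sum_mul, diffOp]
  simp only [ell_update, iteratedDeriv_succ, iteratedDeriv_zero, deriv_mul_const_field']

end LaguerreConv

/-! The Schur test for integral operators with nonnegative kernels. -/

section Schur

variable {X : Type*} [MeasurableSpace X] {μ : Measure X}

/-- Hölder's inequality with the kernel split as `k^{1/q} · k^{1/p}`; `p = 1` is separate because
its conjugate exponent is infinite. -/
theorem lintegral_mul_rpow_le {k g : X → ℝ≥0∞} (hk : AEMeasurable k μ) (hg : AEMeasurable g μ)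
    {p : ℝ} (hp : 1 ≤ p) :
    (∫⁻ y, k y * g y ∂μ) ^ p ≤ (∫⁻ y, k y ∂μ) ^ (p - 1) * ∫⁻ y, k y * g y ^ p ∂μ := by
  rcases hp.eq_or_lt with rfl | hp1
  · simp
  have hp0 : 0 < p := by linarith
  have hpq := Real.HolderConjugate.conjExponent hp1
  set q := Real.conjExponent p with hq
  have hq0 : 0 < q := hpq.symm.pos
  have h := ENNReal.lintegral_mul_le_Lp_mul_Lq μ hpq.symm (f := fun y => k y ^ (1 / q))
    (g := fun y => k y ^ (1 / p) * g y) (hk.pow_const _) ((hk.pow_const _).mul hg)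
  have e1 : ∀ y, (k y ^ (1 / q)) ^ q = k y := fun y => by
    rw [← ENNReal.rpow_mul, one_div_mul_cancel hq0.ne', ENNReal.rpow_one]
  have e2 : ∀ y, (k y ^ (1 / p) * g y) ^ p = k y * g y ^ p := fun y => by
    rw [ENNReal.mul_rpow_of_nonneg _ _ hp0.le, ← ENNReal.rpow_mul, one_div_mul_cancel hp0.ne',
      ENNReal.rpow_one]
  have e3 : ∀ y, k y ^ (1 / q) * (k y ^ (1 / p) * g y) = k y * g y := fun y => by
    rw [← mul_assoc, ← ENNReal.rpow_add_of_nonneg _ _ (by positivity) (by positivity)]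
    have : 1 / q + 1 / p = 1 := by
      have := hpq.inv_add_inv_eq_one; simp only [one_div]; linarith
    rw [this, ENNReal.rpow_one]
  simp only [Pi.mul_apply, e1, e2, e3] at h
  have h2 := ENNReal.rpow_le_rpow h hp0.le
  refine h2.trans_eq ?_
  rw [ENNReal.mul_rpow_of_nonneg _ _ hp0.le, ← ENNReal.rpow_mul, ← ENNReal.rpow_mul,
    one_div_mul_cancel hp0.ne', ENNReal.rpow_one]
  congr 2
  have := hpq.inv_add_inv_eq_one
  have h3 : q⁻¹ = 1 - p⁻¹ := by linarith
  rw [one_div, h3, sub_mul, one_mul, inv_mul_cancel₀ hp0.ne']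

variable [SFinite μ]

/-- The bound in one variable contributes `C^{p-1}` through Hölder, and the bound in the other
contributes `C` after Tonelli. -/
theorem lintegral_schur {k : X → X → ℝ≥0∞} (hk : Measurable (Function.uncurry k)) {C : ℝ≥0∞}
    (h1 : ∀ x, ∫⁻ y, k x y ∂μ ≤ C) (h2 : ∀ y, ∫⁻ x, k x y ∂μ ≤ C) {g : X → ℝ≥0∞}
    (hg : AEMeasurable g μ) {p : ℝ} (hp : 1 ≤ p) :
    ∫⁻ x, (∫⁻ y, k x y * g y ∂μ) ^ p ∂μ ≤ C ^ p * ∫⁻ y, g y ^ p ∂μ := by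
  have hkx : ∀ x, Measurable (k x) := fun x => hk.of_uncurry_left
  calc ∫⁻ x, (∫⁻ y, k x y * g y ∂μ) ^ p ∂μ
      ≤ ∫⁻ x, C ^ (p - 1) * ∫⁻ y, k x y * g y ^ p ∂μ ∂μ := by
        refine lintegral_mono fun x => (lintegral_mul_rpow_le (hkx x).aemeasurable hg hp).trans ?_
        exact mul_le_mul_left (ENNReal.rpow_le_rpow (h1 x) (by linarith)) _
    _ = C ^ (p - 1) * ∫⁻ y, ∫⁻ x, k x y * g y ^ p ∂μ ∂μ := by
        have hm : AEMeasurable (Function.uncurry fun x y => k x y * g y ^ p) (μ.prod μ) :=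
          hk.aemeasurable.mul (hg.pow_const p).comp_snd
        have hm' : AEMeasurable (fun x => ∫⁻ y, k x y * g y ^ p ∂μ) μ := hm.lintegral_prod_right'
        rw [lintegral_const_mul'' _ hm', lintegral_lintegral_swap hm]
    _ ≤ C ^ (p - 1) * ∫⁻ y, C * g y ^ p ∂μ := by
        refine mul_le_mul_right (lintegral_mono fun y => ?_) _
        rw [lintegral_mul_const _ hk.of_uncurry_right]
        exact mul_le_mul_left (h2 y) _
    _ = C ^ p * ∫⁻ y, g y ^ p ∂μ := by
        rw [lintegral_const_mul'' _ (hg.pow_const p), ← mul_assoc]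
        congr 1
        nth_rw 2 [← ENNReal.rpow_one C]
        rw [← ENNReal.rpow_add_of_nonneg _ _ (by linarith) zero_le_one, sub_add_cancel]

variable {𝕜 : Type*} [RCLike 𝕜]

theorem aestronglyMeasurable_integral_kernel {K : X → X → ℝ}
    (hK : Measurable (Function.uncurry K)) {f : X → 𝕜} (hf : AEStronglyMeasurable f μ) :
    AEStronglyMeasurable (fun x => ∫ y, K x y • f y ∂μ) μ :=
  AEStronglyMeasurable.integral_prod_right' (f := fun p : X × X => K p.1 p.2 • f p.2)
    (hK.aestronglyMeasurable.smul hf.comp_snd)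

theorem eLpNorm_integral_kernel_le {K : X → X → ℝ} (hK : Measurable (Function.uncurry K))
    {C : ℝ≥0∞} (h1 : ∀ x, ∫⁻ y, ‖K x y‖ₑ ∂μ ≤ C) (h2 : ∀ y, ∫⁻ x, ‖K x y‖ₑ ∂μ ≤ C)
    {p : ℝ≥0∞} (hp : 1 ≤ p) {f : X → 𝕜} (hf : AEStronglyMeasurable f μ) :
    eLpNorm (fun x => ∫ y, K x y • f y ∂μ) p μ ≤ C * eLpNorm f p μ := by
  have hpt : ∀ x, ‖∫ y, K x y • f y ∂μ‖ₑ ≤ ∫⁻ y, ‖K x y‖ₑ * ‖f y‖ₑ ∂μ := fun x =>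
    (enorm_integral_le_lintegral_enorm _).trans_eq (by simp only [enorm_smul])
  rcases eq_or_ne p ∞ with rfl | hp'
  · rw [eLpNorm_exponent_top, eLpNorm_exponent_top]
    refine eLpNormEssSup_le_of_ae_enorm_bound (Eventually.of_forall fun x => (hpt x).trans ?_)
    calc ∫⁻ y, ‖K x y‖ₑ * ‖f y‖ₑ ∂μ ≤ ∫⁻ y, ‖K x y‖ₑ * eLpNormEssSup f μ ∂μ :=
          lintegral_mono_ae ((ae_le_eLpNormEssSup (f := f) (μ := μ)).mono fun y hy => by gcongr)
      _ = (∫⁻ y, ‖K x y‖ₑ ∂μ) * eLpNormEssSup f μ :=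
          lintegral_mul_const _ hK.of_uncurry_left.enorm
      _ ≤ _ := by gcongr; exact h1 x
  · have hp0 : p ≠ 0 := (zero_lt_one.trans_le hp).ne'
    have hpr : 1 ≤ p.toReal := by
      rw [← ENNReal.toReal_one]
      exact ENNReal.toReal_mono hp' hp
    have hpr0 : 0 < p.toReal := by linarith
    rw [eLpNorm_eq_lintegral_rpow_enorm_toReal hp0 hp',
      eLpNorm_eq_lintegral_rpow_enorm_toReal hp0 hp']
    have h := lintegral_schur (k := fun x y => ‖K x y‖ₑ) hK.enorm h1 h2 hf.enorm hpr
    calc _ ≤ (∫⁻ x, (∫⁻ y, ‖K x y‖ₑ * ‖f y‖ₑ ∂μ) ^ p.toReal ∂μ) ^ (1 / p.toReal) := by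
          gcongr with x
          exact hpt x
      _ ≤ (C ^ p.toReal * ∫⁻ y, ‖f y‖ₑ ^ p.toReal ∂μ) ^ (1 / p.toReal) := by
          gcongr
      _ = _ := by
          rw [ENNReal.mul_rpow_of_nonneg _ _ (by positivity), ← ENNReal.rpow_mul,
            mul_one_div_cancel hpr0.ne', ENNReal.rpow_one]

end Schur

/-! ### A class of functions containing `L¹ + L^∞` and every `L^p`. -/

section Domain

variable {X : Type*} [MeasurableSpace X] {μ : Measure X} {𝕜 : Type*} [RCLike 𝕜]

/-- A function is dominated by the sum of an integrable function and a constant. -/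
def AEDominated (f : X → 𝕜) (μ : Measure X) : Prop :=
  AEStronglyMeasurable f μ ∧ ∃ (g : X → ℝ) (c : ℝ), Integrable g μ ∧ ∀ᵐ x ∂μ, ‖f x‖ ≤ g x + c

theorem ae_norm_le_of_memLp_top {f : X → 𝕜} (hf : MemLp f ∞ μ) : ∃ c : ℝ, ∀ᵐ x ∂μ, ‖f x‖ ≤ c := by
  refine ⟨(eLpNormEssSup f μ).toReal, ?_⟩
  have h2 : eLpNormEssSup f μ < ∞ := by simpa using hf.2
  filter_upwards [ae_le_eLpNormEssSup (f := f) (μ := μ)] with x hx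
  rw [← toReal_enorm]
  exact ENNReal.toReal_mono h2.ne hx

theorem MemL1AddLinfty.aeDominated {f : X → 𝕜} (hf : MemL1AddLinfty f μ) : AEDominated f μ := by
  obtain ⟨g, h, hg, hh, rfl⟩ := hf
  obtain ⟨c, hc⟩ := ae_norm_le_of_memLp_top hh
  refine ⟨hg.1.add hh.1, fun x => ‖g x‖, c, (memLp_one_iff_integrable.1 hg).norm, ?_⟩
  filter_upwards [hc] with x hx
  exact (norm_add_le _ _).trans (by gcongr)

/-- For finite `p ≥ 1`, `|f| ≤ |f|^p + 1` pointwise. -/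
theorem MeasureTheory.MemLp.aeDominated {f : X → 𝕜} {p : ℝ≥0∞} (hp : 1 ≤ p) (hf : MemLp f p μ) :
    AEDominated f μ := by
  rcases eq_or_ne p ∞ with rfl | hp'
  · obtain ⟨c, hc⟩ := ae_norm_le_of_memLp_top hf
    exact ⟨hf.1, 0, c, integrable_zero _ _ _, by simpa using hc⟩
  · have hp0 : p ≠ 0 := (zero_lt_one.trans_le hp).ne'
    have hpr : 1 ≤ p.toReal := by
      rw [← ENNReal.toReal_one]
      exact ENNReal.toReal_mono hp' hp
    refine ⟨hf.1, fun x => ‖f x‖ ^ p.toReal, 1, hf.integrable_norm_rpow hp0 hp',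
      Eventually.of_forall fun x => ?_⟩
    rcases le_total ‖f x‖ 1 with h | h
    · have : 0 ≤ ‖f x‖ ^ p.toReal := by positivity
      linarith
    · have := Real.rpow_le_rpow_of_exponent_le h hpr
      rw [Real.rpow_one] at this
      linarith

theorem AEDominated.norm {f : X → 𝕜} (hf : AEDominated f μ) :
    AEDominated (fun x => ‖f x‖) μ := by
  obtain ⟨h, g, c, hg, hc⟩ := hf
  exact ⟨h.norm, g, c, hg, by simpa using hc⟩

/-- Boundedness of `k` handles the integrable part of the majorant, integrability of `k` the
constant part. -/
theorem AEDominated.integrable_smul {f : X → 𝕜} (hf : AEDominated f μ) {k : X → ℝ}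
    (hk : Integrable k μ) {M : ℝ} (hM : ∀ x, |k x| ≤ M) : Integrable (fun x => k x • f x) μ := by
  obtain ⟨h, g, c, hg, hc⟩ := hf
  have hgk : Integrable (fun x => k x * g x) μ := by
    simpa [mul_comm] using hg.bdd_mul hk.1 (Eventually.of_forall hM)
  refine Integrable.mono' (hgk.norm.add (hk.norm.mul_const |c|)) (hk.1.smul h) ?_
  filter_upwards [hc] with x hx
  rw [norm_smul, Pi.add_apply, norm_mul, ← mul_add]
  refine mul_le_mul_of_nonneg_left (hx.trans ?_) (norm_nonneg _)
  exact add_le_add (le_abs_self _) (le_abs_self _)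

end Domain

namespace LaguerreConv

/-! ### The Hilbert basis and expansion in `L²`. -/

section Expansion

variable {d : ℕ} {α : Fin d → ℝ} {𝕜 : Type*} [RCLike 𝕜]

theorem memLp_ofReal_ell (𝕜 : Type*) [RCLike 𝕜] (hα : ∀ i, -1 < α i) (k : Fin d → ℕ) :
    MemLp (fun x => (ell α k x : 𝕜)) 2 (measure α) := (memLp_ell hα k).ofReal

/-- The Laguerre functions as elements of `L²`. -/
def ellLp (𝕜 : Type*) [RCLike 𝕜] (hα : ∀ i, -1 < α i) (k : Fin d → ℕ) : Lp 𝕜 2 (measure α) :=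
  (memLp_ofReal_ell 𝕜 hα k).toLp _

theorem inner_ellLp (hα : ∀ i, -1 < α i) (k : Fin d → ℕ) (f : Lp 𝕜 2 (measure α)) :
    inner 𝕜 (ellLp 𝕜 hα k) f = ∫ x, ell α k x • f x ∂(measure α) := by
  rw [L2.inner_def]
  refine integral_congr_ae ?_
  filter_upwards [(memLp_ofReal_ell 𝕜 hα k).coeFn_toLp] with x hx
  rw [ellLp, hx, RCLike.inner_apply, RCLike.conj_ofReal, RCLike.real_smul_eq_coe_mul, mul_comm]

theorem orthonormal_ellLp (hα : ∀ i, -1 < α i) : Orthonormal 𝕜 (ellLp 𝕜 hα) := by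
  classical
  rw [orthonormal_iff_ite]
  intro j k
  rw [inner_ellLp]
  have : ∫ x, ell α j x • (ellLp 𝕜 hα k) x ∂(measure α) =
      ∫ x, ((ell α j x * ell α k x : ℝ) : 𝕜) ∂(measure α) := by
    refine integral_congr_ae ?_
    filter_upwards [(memLp_ofReal_ell 𝕜 hα k).coeFn_toLp] with x hx
    rw [ellLp, hx, RCLike.real_smul_eq_coe_mul, RCLike.ofReal_mul]
  rw [this, integral_ofReal, integral_ell_mul_ell hα]
  split_ifs <;> simp

theorem integrable_ell_smul (hα : ∀ i, -1 < α i) (k : Fin d → ℕ) {f : (Fin d → ℝ) → 𝕜}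
    (hf : MemLp f 2 (measure α)) : Integrable (fun x => ell α k x • f x) (measure α) := by
  refine ((memLp_ofReal_ell 𝕜 hα k).integrable_mul hf).congr (Eventually.of_forall fun x => ?_)
  simp only [Pi.mul_apply]
  rw [RCLike.real_smul_eq_coe_mul]

/-- The `ℓ_k` are real, so real and imaginary parts have vanishing coefficients separately. -/
theorem ae_eq_zero_of_integral_ell_smul_eq_zero (hα : ∀ i, -1 < α i) {f : (Fin d → ℝ) → 𝕜}
    (hf : MemLp f 2 (measure α)) (h0 : ∀ k, ∫ x, ell α k x • f x ∂(measure α) = 0) :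
    f =ᵐ[measure α] 0 := by
  have hre := ae_eq_zero_of_integral_ell_eq_zero hα hf.re fun k => by
    have h := integral_re (integrable_ell_smul hα k hf)
    rw [h0 k, map_zero] at h
    simpa [RCLike.smul_re] using h
  have him := ae_eq_zero_of_integral_ell_eq_zero hα hf.im fun k => by
    have h := integral_im (integrable_ell_smul hα k hf)
    rw [h0 k, map_zero] at h
    simpa [RCLike.smul_im] using h
  filter_upwards [hre, him] with x h1 h2
  exact RCLike.ext (by simpa using h1) (by simpa using h2)

theorem orthogonal_span_ellLp (hα : ∀ i, -1 < α i) :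
    (Submodule.span 𝕜 (Set.range (ellLp 𝕜 hα)))ᗮ = ⊥ := by
  rw [Submodule.eq_bot_iff]
  intro f hf
  rw [Submodule.mem_orthogonal] at hf
  have h := ae_eq_zero_of_integral_ell_smul_eq_zero hα (Lp.memLp f) fun k => by
    rw [← inner_ellLp hα]
    exact hf _ (Submodule.subset_span ⟨k, rfl⟩)
  exact (Lp.eq_zero_iff_ae_eq_zero).2 h

/-- The Hilbert basis of Laguerre functions. -/
def ellBasis (𝕜 : Type*) [RCLike 𝕜] (hα : ∀ i, -1 < α i) :
    HilbertBasis (Fin d → ℕ) 𝕜 (Lp 𝕜 2 (measure α)) :=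
  HilbertBasis.mkOfOrthogonalEqBot (orthonormal_ellLp hα) (orthogonal_span_ellLp hα)

theorem ellBasis_apply (hα : ∀ i, -1 < α i) (k : Fin d → ℕ) :
    ellBasis 𝕜 hα k = ellLp 𝕜 hα k := by
  rw [ellBasis, HilbertBasis.coe_mkOfOrthogonalEqBot]

theorem memLp_spectralPartialSum (hα : ∀ i, -1 < α i) (t : ℝ) (f : (Fin d → ℝ) → 𝕜)
    (s : Finset (Fin d → ℕ)) : MemLp (spectralPartialSum α t f s) 2 (measure α) := by
  have h : MemLp (fun x => ∑ k ∈ s, (Real.exp (-t * eigenvalue α k) * ell α k x) •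
      ∫ y, ell α k y • f y ∂(measure α)) 2 (measure α) := by
    refine memLp_finsetSum _ fun k _ => ?_
    refine ((memLp_ofReal_ell 𝕜 hα k).const_mul ((Real.exp (-t * eigenvalue α k) : 𝕜) *
      ∫ y, ell α k y • f y ∂(measure α))).ae_eq (Eventually.of_forall fun x => ?_)
    simp only [RCLike.real_smul_eq_coe_mul, RCLike.ofReal_mul]
    ring
  exact h

theorem toLp_spectralPartialSum_zero (hα : ∀ i, -1 < α i) {f : (Fin d → ℝ) → 𝕜}
    (hf : MemLp f 2 (measure α)) (s : Finset (Fin d → ℕ)) :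
    (memLp_spectralPartialSum hα 0 f s).toLp _ =
      ∑ k ∈ s, (ellBasis 𝕜 hα).repr (hf.toLp f) k • ellBasis 𝕜 hα k := by
  refine Lp.ext ?_
  have h1 : ∀ k, ⇑((ellBasis 𝕜 hα).repr (hf.toLp f) k • ellBasis 𝕜 hα k) =ᵐ[measure α]
      fun x => (Real.exp (-0 * eigenvalue α k) * ell α k x) •
        ∫ y, ell α k y • f y ∂(measure α) := fun k => by
    rw [HilbertBasis.repr_apply_apply, ellBasis_apply, inner_ellLp]
    have h2 : ∫ x, ell α k x • (hf.toLp f) x ∂(measure α) =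
        ∫ x, ell α k x • f x ∂(measure α) := by
      refine integral_congr_ae ?_
      filter_upwards [hf.coeFn_toLp] with x hx
      rw [hx]
    rw [h2]
    filter_upwards [Lp.coeFn_smul (∫ x, ell α k x • f x ∂(measure α)) (ellLp 𝕜 hα k),
      (memLp_ofReal_ell 𝕜 hα k).coeFn_toLp] with x hx hx2
    rw [hx, Pi.smul_apply, ellLp, hx2, RCLike.real_smul_eq_coe_mul, smul_eq_mul]
    simp [mul_comm]
  have h3 : ∀ᵐ x ∂(measure α), ∀ k, ((ellBasis 𝕜 hα).repr (hf.toLp f) k • ellBasis 𝕜 hα k) x =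
      (Real.exp (-0 * eigenvalue α k) * ell α k x) • ∫ y, ell α k y • f y ∂(measure α) :=
    ae_all_iff.2 h1
  filter_upwards [h3, (memLp_spectralPartialSum hα 0 f s).coeFn_toLp,
    Lp.coeFn_fun_finsetSum s fun k => (ellBasis 𝕜 hα).repr (hf.toLp f) k • ellBasis 𝕜 hα k]
    with x hx hx2 hx3
  rw [hx2, hx3, spectralPartialSum]
  exact Finset.sum_congr rfl fun k _ => (hx k).symm

/-- The Laguerre functions form a complete system. -/
theorem tendsto_eLpNorm_sub_spectralPartialSum_zero (hα : ∀ i, -1 < α i) {f : (Fin d → ℝ) → 𝕜}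
    (hf : MemLp f 2 (measure α)) :
    Tendsto (fun s => eLpNorm (f - spectralPartialSum α 0 f s) 2 (measure α)) atTop (𝓝 0) := by
  have h : Tendsto (fun s : Finset (Fin d → ℕ) =>
      ∑ k ∈ s, (ellBasis 𝕜 hα).repr (hf.toLp f) k • ellBasis 𝕜 hα k) atTop (𝓝 (hf.toLp f)) :=
    (ellBasis 𝕜 hα).hasSum_repr (hf.toLp f)
  have h2 := (tendsto_const_nhds (x := hf.toLp f)).sub h
  rw [sub_self] at h2
  have h3 := h2.enorm
  rw [enorm_zero] at h3
  refine h3.congr fun s => ?_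
  rw [← toLp_spectralPartialSum_zero hα hf, ← MemLp.toLp_sub, Lp.enorm_toLp]

end Expansion

/-! ### Properties of the semigroup. -/

section Semigroup

variable {d : ℕ} {α : Fin d → ℝ} {𝕜 : Type*} [RCLike 𝕜] {t : ℝ}

theorem semigroup_zero (𝕜 : Type*) [RCLike 𝕜] (α : Fin d → ℝ) (f : (Fin d → ℝ) → 𝕜) :
    semigroup 𝕜 α 0 f = f := by
  ext x
  simp [semigroup]

theorem semigroup_of_pos (ht : 0 < t) (f : (Fin d → ℝ) → 𝕜) :
    semigroup 𝕜 α t f = fun x => ∫ y, kernel α t x y • f y ∂(measure α) := by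
  ext x
  simp [semigroup, ht.ne']

theorem integrable_kernel_smul (hα : ∀ i, -1 < α i) (ht : 0 < t) {f : (Fin d → ℝ) → 𝕜}
    (hf : AEDominated f (measure α)) (x : Fin d → ℝ) :
    Integrable (fun y => kernel α t x y • f y) (measure α) := by
  obtain ⟨M, hM⟩ := exists_kernel_le hα ht x
  exact hf.integrable_smul (integrable_kernel hα ht x) fun y => by
    rw [abs_of_nonneg (kernel_nonneg hα ht x y)]
    exact hM y

theorem aestronglyMeasurable_semigroup (hα : ∀ i, -1 < α i) (ht : 0 ≤ t) {f : (Fin d → ℝ) → 𝕜}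
    (hf : AEStronglyMeasurable f (measure α)) :
    AEStronglyMeasurable (semigroup 𝕜 α t f) (measure α) := by
  rcases ht.eq_or_lt with rfl | ht
  · rwa [semigroup_zero]
  · rw [semigroup_of_pos ht]
    exact aestronglyMeasurable_integral_kernel (measurable_kernel hα ht) hf

theorem eLpNorm_semigroup_le (hα : ∀ i, -1 < α i) (ht : 0 < t) {p : ℝ≥0∞} (hp : 1 ≤ p)
    {f : (Fin d → ℝ) → 𝕜} (hf : AEStronglyMeasurable f (measure α)) :
    eLpNorm (semigroup 𝕜 α t f) p (measure α) ≤
      ENNReal.ofReal (Real.cosh (2 * t) ^ (-(∑ i, α i + d))) * eLpNorm f p (measure α) := by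
  rw [semigroup_of_pos ht]
  refine eLpNorm_integral_kernel_le (measurable_kernel hα ht) (lintegral_enorm_kernel_le hα ht)
    (fun y => ?_) hp hf
  simp only [kernel_symm α t _ y]
  exact lintegral_enorm_kernel_le hα ht y

theorem eLpNorm_semigroup_le_self (hd : 1 ≤ d) (hα : ∀ i, -1 < α i) (ht : 0 ≤ t) {p : ℝ≥0∞}
    (hp : 1 ≤ p) {f : (Fin d → ℝ) → 𝕜} (hf : AEStronglyMeasurable f (measure α)) :
    eLpNorm (semigroup 𝕜 α t f) p (measure α) ≤ eLpNorm f p (measure α) := by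
  rcases ht.eq_or_lt with rfl | ht
  · rw [semigroup_zero]
  · refine (eLpNorm_semigroup_le hα ht hp hf).trans (mul_le_of_le_one_left zero_le ?_)
    rw [← ENNReal.ofReal_one]
    exact ENNReal.ofReal_le_ofReal (cosh_rpow_lt_one hd hα ht).le

theorem memLp_semigroup (hd : 1 ≤ d) (hα : ∀ i, -1 < α i) (ht : 0 ≤ t) {p : ℝ≥0∞} (hp : 1 ≤ p)
    {f : (Fin d → ℝ) → 𝕜} (hf : MemLp f p (measure α)) :
    MemLp (semigroup 𝕜 α t f) p (measure α) :=
  ⟨aestronglyMeasurable_semigroup hα ht hf.1,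
    (eLpNorm_semigroup_le_self hd hα ht hp hf.1).trans_lt hf.2⟩

theorem semigroup_add_apply (hα : ∀ i, -1 < α i) {s : ℝ} (hs : 0 < s) (ht : 0 < t)
    {f : (Fin d → ℝ) → 𝕜} (hf : AEDominated f (measure α)) (x : Fin d → ℝ) :
    semigroup 𝕜 α (s + t) f x = semigroup 𝕜 α s (semigroup 𝕜 α t f) x := by
  rw [semigroup_of_pos (add_pos hs ht), semigroup_of_pos hs, semigroup_of_pos ht]
  simp only
  have hi : ∀ y, Integrable (fun z => kernel α s x z * kernel α t z y) (measure α) := fun y => by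
    simp only [kernel_symm α t _ y]
    exact (memLp_kernel hα hs x).integrable_mul (memLp_kernel hα ht y)
  have hprod : Integrable (Function.uncurry fun z y =>
      kernel α s x z • (kernel α t z y • f y)) ((measure α).prod (measure α)) := by
    have hm : AEStronglyMeasurable (Function.uncurry fun z y =>
        kernel α s x z • (kernel α t z y • f y)) ((measure α).prod (measure α)) :=
      ((measurable_kernel_right hα hs x).comp measurable_fst).aestronglyMeasurable.smul
        ((measurable_kernel hα ht).aestronglyMeasurable.smul hf.1.comp_snd)
    -- Since the kernels are nonnegative, integrating absolute values in `z` first collapses by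
    -- Chapman-Kolmogorov to the kernel at time `s + t` against `|f|`.
    refine (integrable_prod_iff' hm).2 ⟨Eventually.of_forall fun y => ?_, ?_⟩
    · simp only [Function.uncurry, smul_smul]
      exact (hi y).smul_const _
    · refine (integrable_kernel_smul hα (add_pos hs ht) hf.norm x).congr
        (Eventually.of_forall fun y => ?_)
      simp only [Function.uncurry, smul_smul, norm_smul]
      rw [integral_mul_const, ← integral_kernel_mul_kernel hα hs ht, smul_eq_mul]
      congr 1
      refine integral_congr_ae (Eventually.of_forall fun z => ?_)
      exact (Real.norm_of_nonneg
        (mul_nonneg (kernel_nonneg hα hs x z) (kernel_nonneg hα ht z y))).symm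
  simp only [← integral_smul]
  rw [integral_integral_swap hprod]
  refine integral_congr_ae (Eventually.of_forall fun y => ?_)
  simp only [smul_smul]
  rw [integral_smul_const, integral_kernel_mul_kernel hα hs ht]

theorem semigroup_add (hα : ∀ i, -1 < α i) {s : ℝ} (hs : 0 ≤ s) (ht : 0 ≤ t)
    {f : (Fin d → ℝ) → 𝕜} (hf : AEDominated f (measure α)) :
    semigroup 𝕜 α (s + t) f = semigroup 𝕜 α s (semigroup 𝕜 α t f) := by
  rcases hs.eq_or_lt with rfl | hs
  · rw [zero_add, semigroup_zero]
  rcases ht.eq_or_lt with rfl | ht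
  · rw [add_zero, semigroup_zero]
  exact funext (semigroup_add_apply hα hs ht hf)

theorem integral_semigroup_mul_star (hd : 1 ≤ d) (hα : ∀ i, -1 < α i) (ht : 0 ≤ t)
    {f g : (Fin d → ℝ) → 𝕜} (hf : MemLp f 2 (measure α)) (hg : MemLp g 2 (measure α)) :
    ∫ x, semigroup 𝕜 α t f x * star (g x) ∂(measure α) =
      ∫ x, f x * star (semigroup 𝕜 α t g x) ∂(measure α) := by
  rcases ht.eq_or_lt with rfl | ht
  · rw [semigroup_zero, semigroup_zero]
  have hfd := hf.aeDominated one_le_two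
  have hprod : Integrable (Function.uncurry fun x y =>
      (kernel α t x y • f y) * star (g x)) ((measure α).prod (measure α)) := by
    have hm : AEStronglyMeasurable (Function.uncurry fun x y =>
        (kernel α t x y • f y) * star (g x)) ((measure α).prod (measure α)) :=
      ((measurable_kernel hα ht).aestronglyMeasurable.smul hf.1.comp_snd).mul
        (continuous_star.comp_aestronglyMeasurable hg.1.comp_fst)
    refine (integrable_prod_iff hm).2 ⟨Eventually.of_forall fun x => ?_, ?_⟩
    · simp only [Function.uncurry]
      exact (integrable_kernel_smul hα ht hfd x).mul_const _
    -- Fubini is justified because `T_t |f|` and `|g|` are both in `L²`.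
    · have h1 := memLp_semigroup hd hα ht.le one_le_two hf.norm
      refine (h1.integrable_mul hg.norm).congr (Eventually.of_forall fun x => ?_)
      rw [semigroup_of_pos ht]
      simp only [Function.uncurry, Pi.mul_apply, norm_mul, norm_star, norm_smul]
      rw [integral_mul_const]
      congr 1
      refine integral_congr_ae (Eventually.of_forall fun y => ?_)
      simp only [smul_eq_mul]
      rw [Real.norm_of_nonneg (kernel_nonneg hα ht x y)]
  rw [semigroup_of_pos ht, semigroup_of_pos ht]
  simp only [← integral_mul_const]
  rw [integral_integral_swap hprod]
  refine integral_congr_ae (Eventually.of_forall fun y => ?_)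
  have e : star (∫ x, kernel α t y x • g x ∂(measure α)) =
      ∫ x, star (kernel α t y x • g x) ∂(measure α) := integral_conj.symm
  simp only
  rw [e, ← integral_const_mul]
  refine integral_congr_ae (Eventually.of_forall fun x => ?_)
  simp only [RCLike.real_smul_eq_coe_mul, star_mul', RCLike.star_def, RCLike.conj_ofReal]
  rw [kernel_symm α t x y]
  ring

theorem semigroup_spectralPartialSum (hα : ∀ i, -1 < α i) (ht : 0 < t) (f : (Fin d → ℝ) → 𝕜)
    (s : Finset (Fin d → ℕ)) :
    semigroup 𝕜 α t (spectralPartialSum α 0 f s) = spectralPartialSum α t f s := by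
  rw [semigroup_of_pos ht]
  ext x
  have h : ∀ k, Integrable (fun y => (kernel α t x y * ell α k y) •
      ∫ y, ell α k y • f y ∂(measure α)) (measure α) := fun k =>
    ((memLp_kernel hα ht x).integrable_mul (memLp_ell hα k)).smul_const _
  simp only [spectralPartialSum, Finset.smul_sum, smul_smul, neg_zero, zero_mul, Real.exp_zero,
    one_mul]
  rw [integral_finsetSum _ fun k _ => h k]
  refine Finset.sum_congr rfl fun k _ => ?_
  rw [integral_smul_const, integral_kernel_mul_ell hα ht]

theorem semigroup_sub (hα : ∀ i, -1 < α i) (ht : 0 ≤ t) {f g : (Fin d → ℝ) → 𝕜}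
    (hf : AEDominated f (measure α)) (hg : AEDominated g (measure α)) :
    semigroup 𝕜 α t (f - g) = semigroup 𝕜 α t f - semigroup 𝕜 α t g := by
  rcases ht.eq_or_lt with rfl | ht
  · simp only [semigroup_zero]
  simp only [semigroup_of_pos ht]
  ext x
  simp only [Pi.sub_apply, smul_sub]
  exact integral_sub (integrable_kernel_smul hα ht hf x) (integrable_kernel_smul hα ht hg x)

theorem semigroup_map_add (hα : ∀ i, -1 < α i) (ht : 0 ≤ t) {f g : (Fin d → ℝ) → 𝕜}
    (hf : AEDominated f (measure α)) (hg : AEDominated g (measure α)) :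
    semigroup 𝕜 α t (f + g) = semigroup 𝕜 α t f + semigroup 𝕜 α t g := by
  rcases ht.eq_or_lt with rfl | ht
  · simp only [semigroup_zero]
  simp only [semigroup_of_pos ht]
  ext x
  simp only [Pi.add_apply, smul_add]
  exact integral_add (integrable_kernel_smul hα ht hf x) (integrable_kernel_smul hα ht hg x)

theorem semigroup_map_smul (α : Fin d → ℝ) (ht : 0 ≤ t) (c : 𝕜) (f : (Fin d → ℝ) → 𝕜) :
    semigroup 𝕜 α t (c • f) = c • semigroup 𝕜 α t f := by
  rcases ht.eq_or_lt with rfl | ht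
  · simp only [semigroup_zero]
  simp only [semigroup_of_pos ht]
  ext x
  simp only [Pi.smul_apply, smul_comm _ c]
  exact integral_smul c _

theorem semigroup_congr_ae (ht : 0 ≤ t) {f g : (Fin d → ℝ) → 𝕜} (h : f =ᵐ[measure α] g) :
    semigroup 𝕜 α t f =ᵐ[measure α] semigroup 𝕜 α t g := by
  rcases ht.eq_or_lt with rfl | ht
  · simpa only [semigroup_zero] using h
  simp only [semigroup_of_pos ht]
  refine Eventually.of_forall fun x => integral_congr_ae ?_
  filter_upwards [h] with y hy
  rw [hy]

/-- The error at time `t` is `T_t` applied to the error at time `0`, and `T_t` is a contraction; the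
bound is uniform in `t`. -/
theorem eLpNorm_semigroup_sub_spectralPartialSum_le (hd : 1 ≤ d) (hα : ∀ i, -1 < α i) (ht : 0 ≤ t)
    {f : (Fin d → ℝ) → 𝕜} (hf : MemLp f 2 (measure α)) (s : Finset (Fin d → ℕ)) :
    eLpNorm (semigroup 𝕜 α t f - spectralPartialSum α t f s) 2 (measure α) ≤
      eLpNorm (f - spectralPartialSum α 0 f s) 2 (measure α) := by
  rcases ht.eq_or_lt with rfl | ht
  · rw [semigroup_zero]
  have hs := memLp_spectralPartialSum hα 0 f s
  rw [← semigroup_spectralPartialSum hα ht, ← semigroup_sub hα ht.le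
    (hf.aeDominated one_le_two) (hs.aeDominated one_le_two)]
  exact eLpNorm_semigroup_le_self hd hα ht.le one_le_two (hf.sub hs).1

theorem tendsto_eLpNorm_semigroup_sub_spectralPartialSum (hd : 1 ≤ d) (hα : ∀ i, -1 < α i)
    (ht : 0 ≤ t) {f : (Fin d → ℝ) → 𝕜} (hf : MemLp f 2 (measure α)) :
    Tendsto (fun s => eLpNorm (semigroup 𝕜 α t f - spectralPartialSum α t f s) 2 (measure α))
      atTop (𝓝 0) :=
  tendsto_of_tendsto_of_tendsto_of_le_of_le tendsto_const_nhds
    (tendsto_eLpNorm_sub_spectralPartialSum_zero hα hf) (fun _ => zero_le)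
    fun s => eLpNorm_semigroup_sub_spectralPartialSum_le hd hα ht hf s

theorem tendsto_spectralPartialSum_sub (hα : ∀ i, -1 < α i) (f : (Fin d → ℝ) → 𝕜)
    (s : Finset (Fin d → ℕ)) :
    Tendsto (fun t => eLpNorm (spectralPartialSum α t f s - spectralPartialSum α 0 f s) 2
      (measure α)) (𝓝 0) (𝓝 0) := by
  set e : (Fin d → ℕ) → (Fin d → ℝ) → 𝕜 := fun k x =>
    ell α k x • ∫ y, ell α k y • f y ∂(measure α) with he
  have hem : ∀ k, MemLp (e k) 2 (measure α) := fun k => by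
    have := memLp_spectralPartialSum hα 0 f {k}
    refine this.ae_eq (Eventually.of_forall fun x => ?_)
    simp [spectralPartialSum, he]
  have hle : ∀ t, eLpNorm (spectralPartialSum α t f s - spectralPartialSum α 0 f s) 2
      (measure α) ≤ ∑ k ∈ s, ‖Real.exp (-t * eigenvalue α k) - 1‖ₑ *
        eLpNorm (e k) 2 (measure α) := fun t => by
    have h1 : spectralPartialSum α t f s - spectralPartialSum α 0 f s =
        ∑ k ∈ s, (Real.exp (-t * eigenvalue α k) - 1) • e k := by
      ext x
      simp only [spectralPartialSum, Pi.sub_apply, Finset.sum_apply, Pi.smul_apply, he,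
        ← Finset.sum_sub_distrib, neg_zero, zero_mul, Real.exp_zero, one_mul, mul_smul, sub_smul,
        one_smul]
    rw [h1]
    refine (eLpNorm_sum_le (fun k _ => ((hem k).1.const_smul _)) one_le_two).trans ?_
    exact Finset.sum_le_sum fun k _ => (eLpNorm_const_smul _ _ _ _).le
  refine tendsto_of_tendsto_of_tendsto_of_le_of_le tendsto_const_nhds ?_ (fun _ => zero_le) hle
  have h0 : (0 : ℝ≥0∞) = ∑ k ∈ s, 0 * eLpNorm (e k) 2 (measure α) := by simp
  rw [h0]
  refine tendsto_finsetSum _ fun k _ => ?_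
  have hc : Tendsto (fun t : ℝ => ‖Real.exp (-t * eigenvalue α k) - 1‖ₑ) (𝓝 0) (𝓝 0) := by
    have : Continuous fun t : ℝ => ‖Real.exp (-t * eigenvalue α k) - 1‖ₑ := by fun_prop
    simpa using this.tendsto 0
  exact ENNReal.Tendsto.mul_const hc (Or.inr (hem k).2.ne)

/-- An `ε/3` argument: a fixed partial sum approximates uniformly in `t`, and only finitely many
exponentials vary with `t`. -/
theorem tendsto_eLpNorm_semigroup_sub_self (hd : 1 ≤ d) (hα : ∀ i, -1 < α i)
    {f : (Fin d → ℝ) → 𝕜} (hf : MemLp f 2 (measure α)) :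
    Tendsto (fun t => eLpNorm (semigroup 𝕜 α t f - f) 2 (measure α)) (𝓝[>] 0) (𝓝 0) := by
  rw [ENNReal.tendsto_nhds_zero]
  intro ε hε
  have hε3 : 0 < ε / 3 := ENNReal.div_pos hε.ne' (by simp)
  obtain ⟨s, hs⟩ := ((ENNReal.tendsto_nhds_zero.1
    (tendsto_eLpNorm_sub_spectralPartialSum_zero hα hf)) (ε / 3) hε3).exists
  have h2 := (ENNReal.tendsto_nhds_zero.1 (tendsto_spectralPartialSum_sub hα f s)) (ε / 3) hε3
  filter_upwards [self_mem_nhdsWithin, nhdsWithin_le_nhds h2] with t ht ht2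
  have ht0 : (0 : ℝ) ≤ t := le_of_lt ht
  have hS0 := memLp_spectralPartialSum hα 0 f s
  have hSt := memLp_spectralPartialSum hα t f s
  have hT := memLp_semigroup hd hα ht0 one_le_two hf
  have e : semigroup 𝕜 α t f - f = (semigroup 𝕜 α t f - spectralPartialSum α t f s) +
      ((spectralPartialSum α t f s - spectralPartialSum α 0 f s) -
        (f - spectralPartialSum α 0 f s)) := by abel
  rw [e]
  refine (eLpNorm_add_le (hT.sub hSt).1 ((hSt.sub hS0).sub (hf.sub hS0)).1 one_le_two).trans ?_
  have h3 := eLpNorm_sub_le (hSt.sub hS0).1 (hf.sub hS0).1 one_le_two (μ := measure α)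
  calc _ ≤ ε / 3 + (ε / 3 + ε / 3) :=
        add_le_add ((eLpNorm_semigroup_sub_spectralPartialSum_le hd hα ht0 hf s).trans hs)
          (h3.trans (add_le_add ht2 hs))
    _ = ε := by rw [← add_assoc, ENNReal.add_thirds]

theorem semigroup_nonneg (hα : ∀ i, -1 < α i) (ht : 0 ≤ t) {f : (Fin d → ℝ) → 𝕜}
    (h0 : ∀ᵐ x ∂(measure α), 0 ≤ f x) : ∀ᵐ x ∂(measure α), 0 ≤ semigroup 𝕜 α t f x := by
  rcases ht.eq_or_lt with rfl | ht
  · rwa [semigroup_zero]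
  rw [semigroup_of_pos ht]
  refine Eventually.of_forall fun x => ?_
  -- In the order on `𝕜`, `0 ≤ f y` means that `f y` is a nonnegative real, so `f` may be replaced
  -- by its real part.
  have e : ∫ y, kernel α t x y • f y ∂(measure α) =
      ∫ y, ((kernel α t x y * RCLike.re (f y) : ℝ) : 𝕜) ∂(measure α) := by
    refine integral_congr_ae ?_
    filter_upwards [h0] with y hy
    obtain ⟨r, _, hr⟩ := RCLike.nonneg_iff_exists_ofReal.1 hy
    rw [RCLike.real_smul_eq_coe_mul, RCLike.ofReal_mul, ← hr, RCLike.ofReal_re]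
  simp only
  rw [e, integral_ofReal, RCLike.ofReal_nonneg]
  refine integral_nonneg_of_ae ?_
  filter_upwards [h0] with y hy
  exact mul_nonneg (kernel_nonneg hα ht x y) (RCLike.nonneg_iff.1 hy).1

theorem semigroup_one (ht : 0 < t) (x : Fin d → ℝ) :
    semigroup 𝕜 α t (fun _ => 1) x = ((∫ y, kernel α t x y ∂(measure α) : ℝ) : 𝕜) := by
  rw [semigroup_of_pos ht]
  simp only [RCLike.real_smul_eq_coe_mul, mul_one]
  rw [integral_ofReal]

theorem isHeatSemigroup (hd : 1 ≤ d) (hα : ∀ i, -1 < α i) :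
    IsHeatSemigroup α (semigroup 𝕜 α) where
  eigen k _ hx := diffOp_ell hα k hx
  memLp := memLp_ell hα
  orthonormal := integral_ell_mul_ell hα
  zero f _ := by rw [semigroup_zero]
  hasSum _ ht _ hf := tendsto_eLpNorm_semigroup_sub_spectralPartialSum hd hα ht hf

theorem isSymmetricDiffusionSemigroup (hd : 1 ≤ d) (hα : ∀ i, -1 < α i) :
    IsSymmetricDiffusionSemigroup (semigroup 𝕜 α) (measure α) where
  aestronglyMeasurable _ ht _ hf := aestronglyMeasurable_semigroup hα ht hf.aeDominated.1
  congr_ae _ ht _ _ _ _ h := semigroup_congr_ae ht h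
  map_add _ ht _ _ hf hg := by rw [semigroup_map_add hα ht hf.aeDominated hg.aeDominated]
  map_smul _ ht c f _ := by rw [semigroup_map_smul α ht c f]
  zero f _ := by rw [semigroup_zero]
  memLp _ hp _ ht _ hf := memLp_semigroup hd hα ht hp hf
  contraction _ hp _ ht := sInf_le fun _ hf => by
    rw [one_mul]
    exact eLpNorm_semigroup_le_self hd hα ht hp hf.1
  semigroup _ hp _ _ hs ht _ hf := by rw [semigroup_add hα hs ht (hf.aeDominated hp)]
  selfAdjoint _ ht _ _ hf hg := integral_semigroup_mul_star hd hα ht hf hg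
  continuous_zero _ hf := tendsto_eLpNorm_semigroup_sub_self hd hα hf

theorem isSubmarkovianSemigroup (hd : 1 ≤ d) (hα : ∀ i, -1 < α i) :
    IsSubmarkovianSemigroup (semigroup 𝕜 α) (measure α) where
  isSymmetricDiffusionSemigroup := isSymmetricDiffusionSemigroup hd hα
  positive _ ht _ _ h0 := semigroup_nonneg hα ht h0
  subconservative t ht := by
    rcases ht.eq_or_lt with rfl | ht
    · rw [semigroup_zero]
      exact Eventually.of_forall fun x => le_refl (1 : 𝕜)
    · refine Eventually.of_forall fun x => ?_
      rw [semigroup_one ht, ← RCLike.ofReal_one, RCLike.ofReal_le_ofReal]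
      exact (integral_kernel_le hα ht x).trans (cosh_rpow_lt_one hd hα ht).le

/-- Without this, `T_t 1 = 1` almost everywhere could hold vacuously. -/
theorem measure_ne_zero (hα : ∀ i, -1 < α i) : measure α ≠ 0 := fun h => by
  have := integral_ell_mul_ell hα 0 0
  rw [h, integral_zero_measure, if_pos rfl] at this
  exact zero_ne_one this

theorem not_isMarkovianSemigroup (hd : 1 ≤ d) (hα : ∀ i, -1 < α i) :
    ¬ IsMarkovianSemigroup (semigroup 𝕜 α) (measure α) := fun h => by
  have : NeZero (measure α) := ⟨measure_ne_zero hα⟩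
  obtain ⟨x, hx⟩ := (h.conservative 1 zero_le_one).exists
  rw [semigroup_one one_pos, ← RCLike.ofReal_one (K := 𝕜)] at hx
  have hx := RCLike.ofReal_injective hx
  exact ((integral_kernel_le hα one_pos x).trans_lt (cosh_rpow_lt_one hd hα one_pos)).ne hx

end Semigroup

end LaguerreConv

end

theorem mainTheorem3 (𝕜 : Type*) [RCLike 𝕜] :
    (∀ (d : ℕ) (_ : 1 ≤ d) (α : Fin d → ℝ) (_ : ∀ i, -1 < α i),
      -- the heat kernel and the integral operators are well defined for `t > 0`
      (∀ t : ℝ, 0 < t →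
        (∀ x ∈ LaguerreConv.orthant d, ∀ y ∈ LaguerreConv.orthant d,
          Summable (fun k : Fin d → ℕ => Real.exp (-t * LaguerreConv.eigenvalue α k) *
            (LaguerreConv.ell α k x * LaguerreConv.ell α k y))) ∧
        ∀ f : (Fin d → ℝ) → 𝕜, MemL1AddLinfty f (LaguerreConv.measure α) →
          ∀ x ∈ LaguerreConv.orthant d,
            Integrable (fun y => LaguerreConv.kernel α t x y • f y) (LaguerreConv.measure α)) ∧
      -- on `L²` they are the operators `exp(-tL)`
      LaguerreConv.IsHeatSemigroup α (LaguerreConv.semigroup 𝕜 α) ∧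
      IsSubmarkovianSemigroup (LaguerreConv.semigroup 𝕜 α) (LaguerreConv.measure α) ∧
      ¬ IsMarkovianSemigroup (LaguerreConv.semigroup 𝕜 α) (LaguerreConv.measure α) ∧
      ∀ p : ℝ≥0∞, 1 ≤ p → ∀ t : ℝ, 0 < t →
        lpOpNorm (LaguerreConv.semigroup 𝕜 α t) p (LaguerreConv.measure α) ≤
          ENNReal.ofReal (Real.cosh (2 * t) ^ (-(∑ i, α i + d)))) ∧
    ∀ a : ℝ, -1 < a → ∀ t : ℝ, 0 < t → ∀ x : ℝ, 0 < x →
      LaguerreConv.semigroup 𝕜 (fun _ : Fin 1 => a) t (fun _ => 1) (fun _ => x) =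
        ((Real.cosh (2 * t) ^ (-a - 1) * Real.exp (-(x ^ 2 * Real.tanh (2 * t)) / 2) : ℝ) : 𝕜) := by
  refine ⟨fun d hd α hα => ⟨fun t ht => ⟨fun x _ y _ =>
    (LaguerreConv.hasSum_kernel hα ht x y).summable, fun f hf x _ =>
    LaguerreConv.integrable_kernel_smul hα ht hf.aeDominated x⟩,
    LaguerreConv.isHeatSemigroup hd hα, LaguerreConv.isSubmarkovianSemigroup hd hα,
    LaguerreConv.not_isMarkovianSemigroup hd hα, fun p hp t ht => sInf_le fun f hf =>
    LaguerreConv.eLpNorm_semigroup_le hα ht hp hf.1⟩, fun a ha t ht x _ => ?_⟩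
  rw [LaguerreConv.semigroup_one ht, LaguerreConv.integral_kernel (fun _ => ha) ht]
  simp
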